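/- Let $S_n$ be the set of permutations of $\{1,\dots,n\}$. A crossing of $\sigma\in S_n$ is a pair of indices $(i,j)$ with $i<j<\sigma(i)<\sigma(j)$ or $\sigma(i)<\sigma(j)\le i<j$; a nesting of $\sigma$ is a pair $(i,j)$ with $i<j<\sigma(j)<\sigma(i)$ or $\sigma(j)<\sigma(i)\le i<j$. Let $\mathrm{crs}(\sigma)$ and $\mathrm{nes}(\sigma)$ be the numbers of crossings and nestings of $\sigma$. For a pattern $\tau\in S_3$, let $S_n(\tau)$ be the set of $\sigma\in S_n$ that avoid $\tau$, i.e. for which there are no positions $i_1<i_2<i_3$ such that $\sigma(i_1),\sigma(i_2),\sigma(i_3)$ are in the same relative order as $\tau(1),\tau(2),\tau(3)$. For a tuple of statistics $(\mathrm{st}_1,\dots,\mathrm{st}_k)$, call $\tau,\tau'\in S_3$ $(\mathrm{st}_1,\dots,\mathrm{st}_k)$-Wilf-equivalent if for every $n$ $$\sum_{\sigma\in S_n(\tau)}x_1^{\mathrm{st}_1(\sigma)}\cdots x_k^{\mathrm{st}_k(\sigma)}=\sum_{\sigma\in S_n(\tau')}x_1^{\mathrm{st}_1(\sigma)}\cdots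 x_k^{\mathrm{st}_k(\sigma)},$$ and let $[\tau]_{\mathrm{st}_1,\dots,\mathrm{st}_k}$ be the class of $\tau$ in $S_3$. **Theorem.** For the patterns in $S_3$: 1. the $\mathrm{nes}$-Wilf-equivalence classes are $\{123\}$, $\{321\}$, $[132]_{\mathrm{nes}}=\{132,213\}$ and $[231]_{\mathrm{nes}}=\{231,312\}$; 2. the $\mathrm{crs}$-Wilf-equivalence classes are $\{123\}$, $\{312\}$, $\{231\}$ and $[132]_{\mathrm{crs}}=\{132,213,321\}$; 3. the $(\mathrm{crs},\mathrm{nes})$-Wilf-equivalence classes are $\{123\}$, $\{321\}$, $\{312\}$, $\{231\}$ and $[132]_{\mathrm{crs},\mathrm{nes}}=\{132,213\}$. -/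

import Mathlib

namespace PermPattern

/-- `S_n`, the set of all permutations of `n` linearly ordered letters. Positions and letters are
`0, …, n - 1` instead of `1, …, n`; all notions below only compare positions and letters with one
another, so that this common shift changes nothing. -/
abbrev S (n : ℕ) : Type := Equiv.Perm (Fin n)

/-- A permutation of any length, regarded as a pattern. -/
abbrev Pattern : Type := Σ k : ℕ, S k

/-- `σ` contains an occurrence of `τ`: there are positions `i_1 < ⋯ < i_k` such that the letters
`σ(i_1), …, σ(i_k)` are in the same relative order as `τ(1), …, τ(k)`. -/
def Contains {k n : ℕ} (τ : S k) (σ : S n) : Prop :=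
  ∃ i : Fin k → Fin n, StrictMono i ∧ ∀ a b : Fin k, σ (i a) < σ (i b) ↔ τ a < τ b

open Classical in
/-- `S_n(T)`: the permutations of length `n` that avoid every pattern in `T`. -/
noncomputable def avoiders (T : Set Pattern) (n : ℕ) : Finset (S n) :=
  Finset.univ.filter fun σ => ∀ τ ∈ T, ¬ Contains τ.2 σ

/-- A permutation statistic. -/
abbrev Statistic : Type := ∀ n : ℕ, S n → ℕ

/-- `(i, j)` is a crossing of `σ`. -/
def IsCrossing {n : ℕ} (σ : S n) (i j : Fin n) : Prop :=
  (i < j ∧ j < σ i ∧ σ i < σ j) ∨ (σ i < σ j ∧ σ j ≤ i ∧ i < j)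

/-- `(i, j)` is a nesting of `σ`. -/
def IsNesting {n : ℕ} (σ : S n) (i j : Fin n) : Prop :=
  (i < j ∧ j < σ j ∧ σ j < σ i) ∨ (σ j < σ i ∧ σ i ≤ i ∧ i < j)

instance {n : ℕ} (σ : S n) (i j : Fin n) : Decidable (IsCrossing σ i j) := by
  unfold IsCrossing; infer_instance

instance {n : ℕ} (σ : S n) (i j : Fin n) : Decidable (IsNesting σ i j) := by
  unfold IsNesting; infer_instance

/-- The number of crossings. -/
def crs : Statistic := fun n σ =>
  (Finset.univ.filter fun p : Fin n × Fin n => IsCrossing σ p.1 p.2).card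

/-- The number of nestings. -/
def nes : Statistic := fun n σ =>
  (Finset.univ.filter fun p : Fin n × Fin n => IsNesting σ p.1 p.2).card

/-- The generating polynomial `∑_{σ ∈ S_n(T)} x_1^{st_1(σ)} ⋯ x_k^{st_k(σ)}`. -/
noncomputable def genPoly {k : ℕ} (st : Fin k → Statistic) (T : Set Pattern) (n : ℕ) :
    MvPolynomial (Fin k) ℤ :=
  ∑ σ ∈ avoiders T n, ∏ m : Fin k, (MvPolynomial.X m) ^ (st m n σ)

/-- `T` and `T'` are `(st_1, …, st_k)`-Wilf-equivalent. -/
def WilfEquiv {k : ℕ} (st : Fin k → Statistic) (T T' : Set Pattern) : Prop :=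
  ∀ n : ℕ, genPoly st T n = genPoly st T' n

/-- `(st_1, …, st_k)`-Wilf-equivalence of single patterns of length `l`. -/
def wilfSetoid {k : ℕ} (st : Fin k → Statistic) (l : ℕ) : Setoid (S l) where
  r τ τ' := WilfEquiv st {⟨l, τ⟩} {⟨l, τ'⟩}
  iseqv := ⟨fun _ _ => rfl, fun h n => (h n).symm, fun h h' n => (h n).trans (h' n)⟩

/-- The set of all `(st_1, …, st_k)`-Wilf-equivalence classes of single patterns of length `l`. -/
def wilfClasses {k : ℕ} (st : Fin k → Statistic) (l : ℕ) : Set (Set (S l)) :=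
  (wilfSetoid st l).classes

/-- The class `[τ]_{st_1, …, st_k}` of `τ` among the single patterns of the same length. -/
def wilfClass {k l : ℕ} (st : Fin k → Statistic) (τ : S l) : Set (S l) :=
  {τ' | WilfEquiv st {⟨l, τ'⟩} {⟨l, τ⟩}}

/-! The six permutations of length three: the first vector is the word of the permutation (with
letters lowered by one), the second is the word of the inverse permutation. -/

/-- `123` -/
def p123 : S 3 := ⟨![0, 1, 2], ![0, 1, 2], by decide, by decide⟩
/-- `132` -/
def p132 : S 3 := ⟨![0, 2, 1], ![0, 2, 1], by decide, by decide⟩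
/-- `213` -/
def p213 : S 3 := ⟨![1, 0, 2], ![1, 0, 2], by decide, by decide⟩
/-- `231` -/
def p231 : S 3 := ⟨![1, 2, 0], ![2, 0, 1], by decide, by decide⟩
/-- `312` -/
def p312 : S 3 := ⟨![2, 0, 1], ![1, 2, 0], by decide, by decide⟩
/-- `321` -/
def p321 : S 3 := ⟨![2, 1, 0], ![2, 1, 0], by decide, by decide⟩

end PermPattern

open PermPattern

namespace PermPattern

/-! Inequivalence is a finite matter: putting 2 for the variable in the polynomials of length 4
already separates the classes for `nes` and for `crs`, and joint equivalence implies both single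
ones. Two of the equivalences are symmetries. Reflecting the graph in the antidiagonal preserves
`crs` and `nes` and exchanges 132 with 213. Inversion exchanges 231 with 312; it preserves `nes`
although fixed points count as lower arcs, because a fixed point lies under equally many upper and
lower arcs.

The real work is that 132 and 321 agree for `crs`. With q = s ^ 2, both distributions are reduced to
one three-term recursion.

For 321, `crs` counts pairs of a position and an upper arc over it. After inversion this is an area
that grows simply when a last letter is appended. The resulting generating tree gives the
distribution of length t + 1 as (T ^ t 1)(0), T being the operator `transfer`, and T is tridiagonal
on q-binomial coefficients (`transfer_qBinom_succ`).

For 132, cutting at the greatest letter gives a Catalan recursion, that is, a sum over balanced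
words with letters at integers. By `card_crossPts_top`, a pair at a, b has weight s ^ ||a| - |b||,
and for length t + 1 the letters are at -t, …, t + 1. If a is farthest from the origin, this weight
is s ^ |a| * s ^ (-|b|), so a can be deleted, leaving b unmatched with its own weight. Deleting t +
1, and then t and -t together again and again, changes the number 2 g + 1 of unmatched letters by
-2, 0 or 2. This is again a three-term recursion, and `transferMoment_mul_pow` identifies the two up
to powers of q. -/

/-! ### Patterns of length three and specialisations of the generating polynomial -/

/-- A decidable form of containment of a pattern of length three. -/
def ContainsThree {n : ℕ} (τ : S 3) (σ : S n) : Prop :=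
  ∃ a b c : Fin n, a < b ∧ b < c ∧ (σ a < σ b ↔ τ 0 < τ 1) ∧ (σ a < σ c ↔ τ 0 < τ 2) ∧
    (σ b < σ c ↔ τ 1 < τ 2)

instance {n : ℕ} (τ : S 3) (σ : S n) : Decidable (ContainsThree τ σ) := by
  unfold ContainsThree; infer_instance

theorem iff_swap_of_injective {α β : Type*} [LinearOrder α] [LinearOrder β] {a b : α} {c d : β}
    (hab : a ≠ b) (hcd : c ≠ d) (h : a < b ↔ c < d) : b < a ↔ d < c := by
  rw [← not_iff_not, not_lt, not_lt, le_iff_lt_or_eq, le_iff_lt_or_eq, h]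
  simp [hab, hcd]

theorem contains_iff_containsThree {n : ℕ} (τ : S 3) (σ : S n) :
    Contains τ σ ↔ ContainsThree τ σ := by
  constructor
  · rintro ⟨i, hi, h⟩
    exact ⟨i 0, i 1, i 2, hi (by decide), hi (by decide), h _ _, h _ _, h _ _⟩
  · rintro ⟨a, b, c, hab, hbc, h1, h2, h3⟩
    have hac := hab.trans hbc
    refine ⟨![a, b, c], ?_, ?_⟩
    · intro x y hxy
      fin_cases x <;> fin_cases y <;> simp_all
    -- The three given comparisons determine the reversed ones, since the letters are distinct.
    · have k1 := iff_swap_of_injective (σ.injective.ne hab.ne) (τ.injective.ne (by decide)) h1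
      have k2 := iff_swap_of_injective (σ.injective.ne hac.ne) (τ.injective.ne (by decide)) h2
      have k3 := iff_swap_of_injective (σ.injective.ne hbc.ne) (τ.injective.ne (by decide)) h3
      intro x y
      fin_cases x <;> fin_cases y <;> simp_all

theorem mem_avoiders {n : ℕ} (τ : S 3) (σ : S n) :
    σ ∈ avoiders {⟨3, τ⟩} n ↔ ¬ ContainsThree τ σ := by
  simp [avoiders, contains_iff_containsThree]

/-- The number of avoiders of length `n`, weighted by `2 ^ st`. -/
def weightTwo (st : Statistic) (τ : S 3) (n : ℕ) : ℕ :=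
  ∑ σ : S n, if ContainsThree τ σ then 0 else 2 ^ st n σ

theorem eval_genPoly {k : ℕ} (st : Fin k → Statistic) (T : Set Pattern) (n : ℕ) (x : Fin k → ℤ) :
    MvPolynomial.eval x (genPoly st T n) = ∑ σ ∈ avoiders T n, ∏ m, x m ^ st m n σ := by
  simp [genPoly]

theorem avoiders_eq_filter (τ : S 3) (n : ℕ) :
    avoiders {⟨3, τ⟩} n = Finset.univ.filter fun σ => ¬ ContainsThree τ σ := by
  ext σ; simp [mem_avoiders]

theorem weightTwo_eq_sum (st : Statistic) (τ : S 3) (n : ℕ) :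
    (weightTwo st τ n : ℤ) = ∑ σ ∈ avoiders {⟨3, τ⟩} n, 2 ^ st n σ := by
  rw [avoiders_eq_filter, Finset.sum_filter, weightTwo, Nat.cast_sum]
  refine Finset.sum_congr rfl fun σ _ => ?_
  split_ifs <;> simp_all

theorem weightTwo_eq_of_wilfEquiv {st : Statistic} {τ τ' : S 3}
    (h : WilfEquiv ![st] {⟨3, τ⟩} {⟨3, τ'⟩}) (n : ℕ) : weightTwo st τ n = weightTwo st τ' n := by
  have := congrArg (MvPolynomial.eval ![2]) (h n)
  rw [eval_genPoly, eval_genPoly] at this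
  zify
  simpa [weightTwo_eq_sum] using this

/-- Put 1 for the other variable. -/
theorem wilfEquiv_fst {st st' : Statistic} {T T' : Set Pattern} (h : WilfEquiv ![st, st'] T T') :
    WilfEquiv ![st] T T' := fun n => by
  have := congrArg (MvPolynomial.aeval (R := ℤ) ![(MvPolynomial.X 0 : MvPolynomial (Fin 1) ℤ), 1]) (h n)
  simpa [genPoly, Fin.prod_univ_two] using this

theorem wilfEquiv_snd {st st' : Statistic} {T T' : Set Pattern} (h : WilfEquiv ![st, st'] T T') :
    WilfEquiv ![st'] T T' := fun n => by
  have := congrArg (MvPolynomial.aeval (R := ℤ) ![1, (MvPolynomial.X 0 : MvPolynomial (Fin 1) ℤ)]) (h n)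
  simpa [genPoly, Fin.prod_univ_two] using this

/-- A statistic-preserving bijection between the avoiders gives Wilf-equivalence. -/
theorem wilfEquiv_of_equiv {k : ℕ} {st : Fin k → Statistic} {τ τ' : S 3}
    (φ : ∀ n, S n ≃ S n) (hφ : ∀ n σ, ContainsThree τ σ ↔ ContainsThree τ' (φ n σ))
    (hst : ∀ n σ m, st m n (φ n σ) = st m n σ) : WilfEquiv st {⟨3, τ⟩} {⟨3, τ'⟩} := fun n => by
  refine Finset.sum_equiv (φ n) (fun σ => ?_) (fun σ _ => ?_)
  · rw [mem_avoiders, mem_avoiders, hφ]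
  · simp [hst]

/-! ### Symmetries: reflection in the antidiagonal and inversion -/

/-- Reverse-complement-inverse. -/
def reverseComplementInverse (n : ℕ) : S n ≃ S n where
  toFun σ := Fin.revPerm * σ⁻¹ * Fin.revPerm
  invFun σ := Fin.revPerm * σ⁻¹ * Fin.revPerm
  left_inv σ := by ext; simp
  right_inv σ := by ext; simp

theorem containsThree_p132 {n : ℕ} (σ : S n) :
    ContainsThree p132 σ ↔ ∃ a b c, a < b ∧ b < c ∧ σ a < σ c ∧ σ c < σ b := by
  simp only [ContainsThree, p132, Equiv.coe_fn_mk]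
  refine exists_congr fun a => exists_congr fun b => exists_congr fun c => ?_
  have := fun h : a < b => σ.injective.ne h.ne
  have := fun h : b < c => σ.injective.ne h.ne
  simp
  grind

theorem containsThree_p213 {n : ℕ} (σ : S n) :
    ContainsThree p213 σ ↔ ∃ a b c, a < b ∧ b < c ∧ σ b < σ a ∧ σ a < σ c := by
  simp only [ContainsThree, p213, Equiv.coe_fn_mk]
  refine exists_congr fun a => exists_congr fun b => exists_congr fun c => ?_
  have := fun h : a < b => σ.injective.ne h.ne
  have := fun h : b < c => σ.injective.ne h.ne
  simp
  grind

theorem containsThree_p231 {n : ℕ} (σ : S n) :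
    ContainsThree p231 σ ↔ ∃ a b c, a < b ∧ b < c ∧ σ c < σ a ∧ σ a < σ b := by
  simp only [ContainsThree, p231, Equiv.coe_fn_mk]
  refine exists_congr fun a => exists_congr fun b => exists_congr fun c => ?_
  have := fun h : a < b => σ.injective.ne h.ne
  have := fun h : b < c => σ.injective.ne h.ne
  have := fun (h : a < b) (h' : b < c) => σ.injective.ne (h.trans h').ne
  simp
  grind

theorem containsThree_p312 {n : ℕ} (σ : S n) :
    ContainsThree p312 σ ↔ ∃ a b c, a < b ∧ b < c ∧ σ b < σ c ∧ σ c < σ a := by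
  simp only [ContainsThree, p312, Equiv.coe_fn_mk]
  refine exists_congr fun a => exists_congr fun b => exists_congr fun c => ?_
  have := fun h : a < b => σ.injective.ne h.ne
  have := fun h : b < c => σ.injective.ne h.ne
  have := fun (h : a < b) (h' : b < c) => σ.injective.ne (h.trans h').ne
  simp
  grind

theorem containsThree_p321 {n : ℕ} (σ : S n) :
    ContainsThree p321 σ ↔ ∃ a b c, a < b ∧ b < c ∧ σ c < σ b ∧ σ b < σ a := by
  simp only [ContainsThree, p321, Equiv.coe_fn_mk]
  refine exists_congr fun a => exists_congr fun b => exists_congr fun c => ?_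
  have := fun h : a < b => σ.injective.ne h.ne
  have := fun h : b < c => σ.injective.ne h.ne
  have := fun (h : a < b) (h' : b < c) => σ.injective.ne (h.trans h').ne
  simp
  grind

theorem reverseComplementInverse_apply {n : ℕ} (σ : S n) (i : Fin n) :
    reverseComplementInverse n σ i = (σ⁻¹ i.rev).rev := rfl

/-- The point of `reverseComplementInverse n σ` that corresponds to the point `(i, σ i)`. -/
theorem reverseComplementInverse_rev {n : ℕ} (σ : S n) (i : Fin n) :
    reverseComplementInverse n σ (σ i).rev = i.rev := by
  simp [reverseComplementInverse_apply]

theorem containsThree_reverseComplementInverse {n : ℕ} (σ : S n) :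
    ContainsThree p132 σ ↔ ContainsThree p213 (reverseComplementInverse n σ) := by
  rw [containsThree_p132, containsThree_p213]
  constructor
  · rintro ⟨a, b, c, h1, h2, h3, h4⟩
    -- The reflection lists points by decreasing letter, which for 132 is the order b, c, a.
    refine ⟨(σ b).rev, (σ c).rev, (σ a).rev, ?_⟩
    simp only [reverseComplementInverse_rev, Fin.rev_lt_rev]
    exact ⟨h4, h3, h2, h1⟩
  · rintro ⟨a, b, c, h1, h2, h3, h4⟩
    refine ⟨σ⁻¹ c.rev, σ⁻¹ a.rev, σ⁻¹ b.rev, ?_⟩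
    simp only [reverseComplementInverse_apply, Fin.rev_lt_rev] at h3 h4
    simpa using ⟨h4, h3, h2, h1⟩

/-- The reflection keeps upper arcs upper and reverses the order of the two arcs of a crossing,
hence the swap of coordinates. The arcs of a nesting keep their order. -/
theorem crs_reverseComplementInverse {n : ℕ} (σ : S n) :
    crs n (reverseComplementInverse n σ) = crs n σ := by
  symm
  refine Finset.card_equiv ((Equiv.prodComm _ _).trans
    ((σ.trans Fin.revPerm).prodCongr (σ.trans Fin.revPerm))) fun ⟨i, j⟩ => ?_
  rw [Finset.mem_filter_univ, Finset.mem_filter_univ]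
  simp only [IsCrossing, Equiv.trans_apply, Equiv.prodComm_apply,
    Prod.swap_prod_mk, Equiv.prodCongr_apply, Prod.map_apply, Fin.revPerm_apply,
    reverseComplementInverse_rev, Fin.rev_lt_rev, Fin.rev_le_rev]
  tauto

theorem nes_reverseComplementInverse {n : ℕ} (σ : S n) :
    nes n (reverseComplementInverse n σ) = nes n σ := by
  symm
  refine Finset.card_equiv
    ((σ.trans Fin.revPerm).prodCongr (σ.trans Fin.revPerm)) fun ⟨i, j⟩ => ?_
  rw [Finset.mem_filter_univ, Finset.mem_filter_univ]
  simp only [IsNesting, Equiv.trans_apply,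
    Equiv.prodCongr_apply, Prod.map_apply, Fin.revPerm_apply,
    reverseComplementInverse_rev, Fin.rev_lt_rev, Fin.rev_le_rev]
  tauto

theorem containsThree_p231_inv {n : ℕ} (σ : S n) :
    ContainsThree p231 σ ↔ ContainsThree p312 σ⁻¹ := by
  rw [containsThree_p231, containsThree_p312]
  constructor
  · rintro ⟨a, b, c, h1, h2, h3, h4⟩
    exact ⟨σ c, σ a, σ b, by simpa using ⟨h3, h4, h1, h2⟩⟩
  · rintro ⟨a, b, c, h1, h2, h3, h4⟩
    exact ⟨σ⁻¹ b, σ⁻¹ c, σ⁻¹ a, by simpa using ⟨h3, h4, h1, h2⟩⟩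

theorem containsThree_p321_inv {n : ℕ} (σ : S n) :
    ContainsThree p321 σ⁻¹ ↔ ContainsThree p321 σ := by
  rw [containsThree_p321, containsThree_p321]
  constructor
  · rintro ⟨a, b, c, h1, h2, h3, h4⟩
    exact ⟨σ⁻¹ c, σ⁻¹ b, σ⁻¹ a, by simpa using ⟨h3, h4, h1, h2⟩⟩
  · rintro ⟨a, b, c, h1, h2, h3, h4⟩
    exact ⟨σ c, σ b, σ a, by simpa using ⟨h3, h4, h1, h2⟩⟩

/-- As many arcs jump over a fixed point to the right as to the left. -/
theorem card_arcs_over_fixed {n : ℕ} (σ : S n) {f : Fin n} (hf : σ f = f) :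
    (Finset.univ.filter fun i => i < f ∧ f < σ i).card =
      (Finset.univ.filter fun j => σ j < f ∧ f < j).card := by
  -- There are as many positions as letters below `f`; the points with both below `f` cancel.
  have h1 : (Finset.univ.filter fun i => i < f).card = (Finset.univ.filter fun i => σ i < f).card :=
    (Finset.card_equiv σ (by simp)).symm
  have h2 := Finset.card_filter_add_card_filter_not (s := Finset.univ.filter fun i => i < f)
    (fun i => σ i < f)
  have h3 := Finset.card_filter_add_card_filter_not (s := Finset.univ.filter fun i => σ i < f)
    (fun i => i < f)
  rw [Finset.filter_filter, Finset.filter_filter] at h2 h3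
  have e1 : (Finset.univ.filter fun i => i < f ∧ ¬ σ i < f) =
      Finset.univ.filter fun i => i < f ∧ f < σ i := by
    ext i
    have : i < f → σ i ≠ f := fun h h' => h.ne (σ.injective (h'.trans hf.symm))
    simp only [Finset.mem_filter_univ]; grind
  have e2 : (Finset.univ.filter fun i => σ i < f ∧ ¬ i < f) =
      Finset.univ.filter fun i => σ i < f ∧ f < i := by
    ext i
    have : i = f → σ i = f := fun h => h ▸ hf
    simp only [Finset.mem_filter_univ]; grind
  have e3 : (Finset.univ.filter fun i => i < f ∧ σ i < f) =
      Finset.univ.filter fun i => σ i < f ∧ i < f := by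
    simp only [and_comm]
  rw [e1, e3] at h2
  rw [e2] at h3
  omega

/-- Nestings, with those that contain a fixed point counted apart. -/
theorem nes_eq_add {n : ℕ} (σ : S n) : nes n σ =
    (Finset.univ.filter fun p : Fin n × Fin n => p.1 < p.2 ∧ p.2 < σ p.2 ∧ σ p.2 < σ p.1).card +
    (Finset.univ.filter fun p : Fin n × Fin n => σ p.2 < σ p.1 ∧ σ p.1 < p.1 ∧ p.1 < p.2).card +
    ∑ f with σ f = f, (Finset.univ.filter fun j => σ j < f ∧ f < j).card := by
  have h3 : ∑ f with σ f = f, (Finset.univ.filter fun j => σ j < f ∧ f < j).card =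
      (Finset.univ.filter fun p : Fin n × Fin n => σ p.1 = p.1 ∧ σ p.2 < p.1 ∧ p.1 < p.2).card := by
    rw [← Finset.card_sigma]
    refine Finset.card_equiv (Equiv.sigmaEquivProd _ _) fun ⟨f, j⟩ => ?_
    simp [Equiv.sigmaEquivProd]
  rw [h3, nes, ← Finset.card_union_of_disjoint, ← Finset.card_union_of_disjoint]
  · congr 1
    ext ⟨i, j⟩
    simp only [IsNesting, Finset.mem_union, Finset.mem_filter_univ]
    grind
  · rw [Finset.disjoint_left]
    simp only [Finset.mem_union, Finset.mem_filter_univ]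
    grind
  · rw [Finset.disjoint_left]
    simp only [Finset.mem_filter_univ]
    grind

/-- Inversion exchanges upper and lower arcs, hence the first two terms of `nes_eq_add`. The term of
the fixed points is unchanged by `card_arcs_over_fixed`. -/
theorem nes_inv {n : ℕ} (σ : S n) : nes n σ⁻¹ = nes n σ := by
  rw [nes_eq_add, nes_eq_add, add_comm (Finset.card _)]
  congr 1
  · congr 1
    · refine Finset.card_equiv ((Equiv.prodComm _ _).trans (σ⁻¹.prodCongr σ⁻¹))
        fun ⟨i, j⟩ => ?_
      simp [and_assoc, and_comm]
    · refine Finset.card_equiv ((Equiv.prodComm _ _).trans (σ⁻¹.prodCongr σ⁻¹))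
        fun ⟨i, j⟩ => ?_
      simp [and_assoc, and_comm]
  · have hfix : ∀ f, σ⁻¹ f = f ↔ σ f = f := fun f => by rw [Equiv.Perm.inv_eq_iff_eq, eq_comm]
    simp only [hfix]
    refine Finset.sum_congr rfl fun f hf => ?_
    rw [← card_arcs_over_fixed σ (Finset.mem_filter.1 hf).2]
    refine Finset.card_equiv σ⁻¹ fun j => ?_
    simp

theorem wilfEquiv_crs_nes_p132_p213 : WilfEquiv ![crs, nes] {⟨3, p132⟩} {⟨3, p213⟩} :=
  wilfEquiv_of_equiv reverseComplementInverse (fun _ => containsThree_reverseComplementInverse)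
    fun n σ m => by
      fin_cases m
      · exact crs_reverseComplementInverse σ
      · exact nes_reverseComplementInverse σ

theorem wilfEquiv_nes_p231_p312 : WilfEquiv ![nes] {⟨3, p231⟩} {⟨3, p312⟩} :=
  wilfEquiv_of_equiv (fun _ => Equiv.inv _) (fun _ => containsThree_p231_inv)
    fun n σ m => by
      fin_cases m
      exact nes_inv σ

/-! ### The transfer operator of 321-avoiding permutations -/

/-- The `q`-binomial coefficient, by its Pascal recursion. -/
noncomputable def qBinom (q : ℝ) : ℕ → ℕ → ℝ
  | _, 0 => 1
  | 0, _ + 1 => 0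
  | b + 1, g + 1 => q ^ (g + 1) * qBinom q b (g + 1) + qBinom q b g

theorem qBinom_zero_right (q : ℝ) (b : ℕ) : qBinom q b 0 = 1 := by cases b <;> simp [qBinom]

theorem qBinom_succ_succ (q : ℝ) (b g : ℕ) :
    qBinom q (b + 1) (g + 1) = q ^ (g + 1) * qBinom q b (g + 1) + qBinom q b g := rfl

/-- The second Pascal recursion, in a form without subtraction. -/
theorem pow_mul_qBinom_succ_succ (q : ℝ) (b g : ℕ) :
    q ^ g * qBinom q (b + 1) (g + 1) = q ^ g * qBinom q b (g + 1) + q ^ b * qBinom q b g := by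
  induction b generalizing g with
  | zero => cases g <;> simp [qBinom]
  | succ b ih =>
    rw [qBinom_succ_succ q (b + 1)]
    have h1 := ih g
    cases g with
    | zero =>
      simp only [qBinom_zero_right, pow_zero, zero_add, one_mul, mul_one, pow_one] at *
      rw [h1, pow_succ]
      have := qBinom_succ_succ q b 0
      simp only [qBinom_zero_right, zero_add, pow_one] at this
      linarith
    | succ g =>
      have h2 := ih g
      have e1 := qBinom_succ_succ q b (g + 1)
      have e2 := qBinom_succ_succ q b g
      linear_combination q ^ (g + 2) * h1 + q * h2 - q ^ (g + 1) * e1 - q ^ (b + 1) * e2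

/-- The q-analogue of the hockey-stick identity: the second Pascal recursion telescopes. -/
theorem sum_pow_mul_qBinom (q : ℝ) (b g : ℕ) :
    ∑ i ∈ Finset.range (b + 1), q ^ i * qBinom q i g = q ^ g * qBinom q (b + 1) (g + 1) := by
  induction b with
  | zero => cases g <;> simp [qBinom]
  | succ b ih => rw [Finset.sum_range_succ, ih, pow_mul_qBinom_succ_succ q (b + 1)]

/-- The operator `f ↦ (b ↦ f (b + 1) + ∑_{i ≤ b} q ^ i f i)`. -/
noncomputable def transfer (q : ℝ) : (ℕ → ℝ) →ₗ[ℝ] (ℕ → ℝ) where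
  toFun f b := f (b + 1) + ∑ i ∈ Finset.range (b + 1), q ^ i * f i
  map_add' f g := by ext b; simp [mul_add, Finset.sum_add_distrib]; ring
  map_smul' c f := by
    ext b
    simp only [Pi.smul_apply, smul_eq_mul, RingHom.id_apply, mul_add, Finset.mul_sum]
    simp only [mul_left_comm]

theorem transfer_apply (q : ℝ) (f : ℕ → ℝ) (b : ℕ) :
    transfer q f b = f (b + 1) + ∑ i ∈ Finset.range (b + 1), q ^ i * f i := rfl

theorem transfer_qBinom_zero (q : ℝ) : transfer q (fun b => qBinom q b 0) =
    q • (fun b => qBinom q b 1) + (2 : ℝ) • (fun b => qBinom q b 0) := by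
  ext b
  simp only [transfer_apply, sum_pow_mul_qBinom, Pi.add_apply, Pi.smul_apply, smul_eq_mul,
    qBinom_succ_succ]
  simp only [qBinom_zero_right]
  ring

/-- By Pascal, the shift contributes to the indices `g` and `g + 1`; by the hockey-stick identity,
the weighted sum contributes to `g + 1` and `g + 2`. Both give the same coefficient at `g + 1`,
hence the 2. -/
theorem transfer_qBinom_succ (q : ℝ) (g : ℕ) : transfer q (fun b => qBinom q b (g + 1)) =
    q ^ (2 * g + 3) • (fun b => qBinom q b (g + 2)) +
      (2 * q ^ (g + 1)) • (fun b => qBinom q b (g + 1)) + (fun b => qBinom q b g) := by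
  ext b
  simp only [transfer_apply, sum_pow_mul_qBinom, Pi.add_apply, Pi.smul_apply, smul_eq_mul,
    qBinom_succ_succ]
  ring

/-- The entries of the powers of `transfer`, in the basis of `q`-binomial coefficients. -/
noncomputable def transferMoment (q : ℝ) (t g : ℕ) : ℝ :=
  (transfer q ^ t) (fun b => qBinom q b g) 0

theorem transferMoment_zero_zero (q : ℝ) : transferMoment q 0 0 = 1 := by
  simp [transferMoment, qBinom]

theorem transferMoment_zero_succ (q : ℝ) (g : ℕ) : transferMoment q 0 (g + 1) = 0 := by
  simp [transferMoment, qBinom]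

theorem transferMoment_succ_zero (q : ℝ) (t : ℕ) : transferMoment q (t + 1) 0 =
    q * transferMoment q t 1 + 2 * transferMoment q t 0 := by
  simp only [transferMoment, pow_succ, Module.End.mul_apply, transfer_qBinom_zero, map_add,
    map_smul, Pi.add_apply, Pi.smul_apply, smul_eq_mul]

theorem transferMoment_succ_succ (q : ℝ) (t g : ℕ) : transferMoment q (t + 1) (g + 1) =
    q ^ (2 * g + 3) * transferMoment q t (g + 2) + 2 * q ^ (g + 1) * transferMoment q t (g + 1) +
      transferMoment q t g := by
  simp only [transferMoment, pow_succ _ t, Module.End.mul_apply, transfer_qBinom_succ, map_add,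
    map_smul, Pi.add_apply, Pi.smul_apply, smul_eq_mul]

/-- One application of `transfer` lowers the index by at most one, and only index 0 has a nonzero
value at 0. -/
theorem transferMoment_eq_zero (q : ℝ) {t g : ℕ} (h : t < g) : transferMoment q t g = 0 := by
  induction t generalizing g with
  | zero => obtain ⟨g, rfl⟩ := Nat.exists_eq_succ_of_ne_zero h.ne'; exact transferMoment_zero_succ q g
  | succ t ih =>
    obtain ⟨g, rfl⟩ := Nat.exists_eq_succ_of_ne_zero (Nat.zero_lt_of_lt h).ne'
    rw [Nat.succ_eq_add_one, transferMoment_succ_succ, ih (by omega), ih (by omega), ih (by omega)]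
    simp

/-! ### Weighted words with letters at the integers -/

/-- The weighted sum over all balanced words of length `2 n` with letters at `p + 1, …, p + 2 n`,
where a matched pair at `a`, `b` has weight `s ^ ||a| - |b||`. -/
noncomputable def dyckSum (s : ℝ) : ℕ → ℤ → ℝ
  | 0, _ => 1
  | n + 1, p => ∑ i : Fin (n + 1), s ^ |(|p + 1| - |p + 2 * (i : ℕ) + 2|)| *
      dyckSum s i (p + 1) * dyckSum s (n - i) (p + 2 * (i : ℕ) + 2)
  decreasing_by all_goals omega

theorem dyckSum_zero (s : ℝ) (p : ℤ) : dyckSum s 0 p = 1 := by rw [dyckSum]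

theorem dyckSum_succ (s : ℝ) (n : ℕ) (p : ℤ) : dyckSum s (n + 1) p =
    ∑ x ∈ Finset.HasAntidiagonal.antidiagonal n, s ^ |(|p + 1| - |p + 2 * x.1 + 2|)| *
      dyckSum s x.1 (p + 1) * dyckSum s x.2 (p + 2 * x.1 + 2) := by
  rw [dyckSum, Finset.Nat.sum_antidiagonal_eq_sum_range_succ_mk, Finset.sum_range]

/-- The weighted sum over all words with `m` matched pairs and `k` unmatched letters at
`p + 1, …, p + k + 2 m`, where an unmatched letter at `a` has weight `s ^ (-|a|)`. -/
noncomputable def openSum (s : ℝ) : ℕ → ℤ → ℕ → ℝ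
  | 0, p, m => dyckSum s m p
  | k + 1, p, m => ∑ x ∈ Finset.HasAntidiagonal.antidiagonal m,
      dyckSum s x.1 p * s ^ (-|p + 2 * x.1 + 1|) * openSum s k (p + 2 * x.1 + 1) x.2

theorem openSum_zero (s : ℝ) (p : ℤ) (m : ℕ) : openSum s 0 p m = dyckSum s m p := rfl

theorem openSum_succ (s : ℝ) (k : ℕ) (p : ℤ) (m : ℕ) : openSum s (k + 1) p m =
    ∑ x ∈ Finset.HasAntidiagonal.antidiagonal m,
      dyckSum s x.1 p * s ^ (-|p + 2 * x.1 + 1|) * openSum s k (p + 2 * x.1 + 1) x.2 := rfl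

/-- The part of `openSum s k p m` from the words whose first letter is unmatched. -/
noncomputable def openSumLead (s : ℝ) : ℕ → ℤ → ℕ → ℝ
  | 0, _, _ => 0
  | k + 1, p, m => s ^ (-|p + 1|) * openSum s k (p + 1) m

/-- The part of `openSum s k p m` from the words whose last letter, at `z`, is unmatched. -/
noncomputable def openSumTrail (s : ℝ) (z : ℤ) : ℕ → ℤ → ℕ → ℝ
  | 0, _, _ => 0
  | k + 1, p, m => s ^ (-|z|) * openSum s k p m

/-- Decomposition by the match of the first letter. -/
theorem openSum_first (s : ℝ) (k : ℕ) (p : ℤ) (m : ℕ) :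
    openSum s k p (m + 1) = openSumLead s k p (m + 1) +
      ∑ x ∈ Finset.HasAntidiagonal.antidiagonal m, s ^ |(|p + 1| - |p + 2 * x.1 + 2|)| *
        dyckSum s x.1 (p + 1) * openSum s k (p + 2 * x.1 + 2) x.2 := by
  cases k with
  | zero => simp only [openSum_zero, openSumLead, zero_add, dyckSum_succ]
  | succ k =>
    rw [openSum_succ, Finset.Nat.sum_antidiagonal_succ, openSumLead]
    congr 1
    · simp [dyckSum_zero]
    · simp only [dyckSum_succ, Finset.sum_mul, openSum_succ, Finset.mul_sum]
      rw [Finset.sum_sigma', Finset.sum_sigma']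
      -- The other pairs lie under the first arc, between it and the first unmatched letter, or
      -- after that letter; the two sides group these three numbers differently.
      refine Finset.sum_bij' (fun x _ => ⟨(x.2.1, x.2.2 + x.1.2), (x.2.2, x.1.2)⟩)
        (fun x _ => ⟨(x.1.1 + x.2.1, x.2.2), (x.1.1, x.2.1)⟩) ?_ ?_ ?_ ?_ ?_
      · rintro ⟨⟨a, b⟩, ⟨c, d⟩⟩; simp; omega
      · rintro ⟨⟨a, b⟩, ⟨c, d⟩⟩; simp; omega
      · rintro ⟨⟨a, b⟩, ⟨c, d⟩⟩; simp
      · rintro ⟨⟨a, b⟩, ⟨c, d⟩⟩; simp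
      · rintro ⟨⟨a, b⟩, ⟨c, d⟩⟩ h
        simp only [Finset.mem_sigma, Finset.HasAntidiagonal.mem_antidiagonal] at h
        obtain ⟨h1, rfl⟩ := h
        have : p + 2 * ((c + d + 1 : ℕ) : ℤ) + 1 = p + 2 * (c : ℤ) + 2 + 2 * (d : ℤ) + 1 := by
          push_cast; ring
        simp only [this]
        ring

/-- Removal of the first letter when it is farthest from the origin. -/
theorem openSum_peel_left {s : ℝ} (hs : s ≠ 0) (k : ℕ) (p : ℤ) (m : ℕ)
    (h : ∀ a, p + 1 < a → a ≤ p + k + 2 * m + 2 → |a| ≤ |p + 1|) :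
    openSum s k p (m + 1) =
      openSumLead s k p (m + 1) + s ^ |p + 1| * openSum s (k + 1) (p + 1) m := by
  rw [openSum_first, openSum_succ, Finset.mul_sum]
  congr 1
  refine Finset.sum_congr rfl fun x hx => ?_
  rw [Finset.HasAntidiagonal.mem_antidiagonal] at hx
  have h1 := h (p + 2 * x.1 + 2) (by omega) (by omega)
  have h2 : p + 1 + 2 * (x.1 : ℤ) + 1 = p + 2 * x.1 + 2 := by ring
  -- As `p + 1` is farthest out, the weight of the pair splits, and the partner keeps exactly the
  -- weight of an unmatched letter.
  rw [abs_of_nonneg (a := |p + 1| - |p + 2 * x.1 + 2|) (by omega), sub_eq_add_neg, zpow_add₀ hs, h2]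
  ring

theorem openSum_succ_zero_last (s : ℝ) (k : ℕ) (p : ℤ) :
    openSum s (k + 1) p 0 = s ^ (-|p + k + 1|) * openSum s k p 0 := by
  induction k generalizing p with
  | zero => simp [openSum_succ, openSum_zero, dyckSum_zero]
  | succ k ih =>
    rw [openSum_succ, openSum_succ s k p]
    simp only [Finset.Nat.antidiagonal_zero, Finset.sum_singleton, ih]
    push_cast
    have : p + 0 + 1 + (k : ℤ) + 1 = p + (k + 1) + 1 := by ring
    rw [this]
    ring

theorem lead_trail (s : ℝ) (z : ℤ) (k : ℕ) (p : ℤ) (m : ℕ) :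
    s ^ (-|p + 1|) * openSumTrail s z k (p + 1) m = s ^ (-|z|) * openSumLead s k p m := by
  cases k <;> simp only [openSumTrail, openSumLead, mul_zero]; ring

/-- Removal of the last letter when it is farthest from the origin. -/
theorem openSum_peel_right {s : ℝ} (hs : s ≠ 0) (m k : ℕ) (p z : ℤ) (hz : z = p + k + 2 * m + 2)
    (h : ∀ a, p < a → a < z → |a| ≤ |z|) :
    openSum s k p (m + 1) =
      openSumTrail s z k p (m + 1) + s ^ |z| * openSum s (k + 1) p m := by
  -- `openSum` is built from the left, so the last letter is reached by first removing the first
  -- letter: if matched, fewer pairs remain behind its partner; if unmatched, `k` drops.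
  induction m using Nat.strong_induction_on generalizing k p with
  | _ m ihm =>
  induction k generalizing p with
  | zero =>
    have hw : s ^ |(|p + 1| - |z|)| = s ^ |z| * s ^ (-|p + 1|) := by
      rw [← zpow_add₀ hs, abs_sub_comm, abs_of_nonneg, sub_eq_add_neg]
      by_cases hh : p + 1 < z
      · have := h (p + 1) (by omega) hh; omega
      · obtain rfl : z = p + 1 := by omega
        simp
    rw [openSum_first, openSumTrail, openSumLead, zero_add, zero_add]
    cases m with
    | zero =>
      obtain rfl : z = p + 2 := by rw [hz]; push_cast; ring
      simpa [openSum_succ, openSum_zero, dyckSum_zero] using hw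
    | succ m =>
      rw [Finset.Nat.sum_antidiagonal_succ', openSum_first s 1 p m, openSumLead, mul_add,
        Finset.mul_sum]
      have e : p + 2 * ((m + 1 : ℕ) : ℤ) + 2 = z := by rw [hz]; push_cast; ring
      simp only [openSum_zero, dyckSum_zero, e, hw]
      congr 1
      · ring
      · refine Finset.sum_congr rfl fun x hx => ?_
        rw [Finset.HasAntidiagonal.mem_antidiagonal] at hx
        have := ihm x.2 (by omega) 0 (p + 2 * x.1 + 2) (by rw [hz]; push_cast; omega)
          (fun a ha ha' => h a (by omega) ha')
        rw [openSum_zero, openSumTrail] at this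
        rw [this]
        ring
  | succ k ihk =>
    have hk := ihk (p + 1) (by rw [hz]; push_cast; ring) (fun a ha ha' => h a (by omega) ha')
    rw [openSum_first, openSumLead, hk, openSumTrail, openSum_first s k p m, mul_add, mul_add,
      lead_trail]
    -- These are the words whose first letter is matched. The difference on the right excludes the
    -- words with `k + 2` unmatched letters that begin with an unmatched one.
    have key : ∑ x ∈ Finset.HasAntidiagonal.antidiagonal m, s ^ |(|p + 1| - |p + 2 * x.1 + 2|)| *
        dyckSum s x.1 (p + 1) * openSum s (k + 1) (p + 2 * x.1 + 2) x.2 =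
        s ^ (-|z|) * ∑ x ∈ Finset.HasAntidiagonal.antidiagonal m, s ^ |(|p + 1| - |p + 2 * x.1 + 2|)| *
          dyckSum s x.1 (p + 1) * openSum s k (p + 2 * x.1 + 2) x.2 +
        s ^ |z| * (openSum s (k + 2) p m - s ^ (-|p + 1|) * openSum s (k + 1) (p + 1) m) := by
      cases m with
      | zero =>
        have e : p + 2 * 0 + 2 + (k : ℤ) + 1 = z := by rw [hz]; push_cast; ring
        rw [openSum_succ s (k + 1), Finset.Nat.antidiagonal_zero, Finset.sum_singleton,
          Finset.sum_singleton, Finset.sum_singleton, openSum_succ_zero_last]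
        simp only [Nat.cast_zero, e, dyckSum_zero]
        have e' : p + 2 * 0 + 1 = p + 1 := by ring
        rw [e']
        ring
      | succ m =>
        have e : p + 2 * ((m + 1 : ℕ) : ℤ) + 2 + (k : ℤ) + 1 = z := by rw [hz]; push_cast; ring
        rw [Finset.Nat.sum_antidiagonal_succ', Finset.Nat.sum_antidiagonal_succ',
          openSum_first s (k + 2) p m, openSumLead, add_sub_cancel_left, Finset.mul_sum, mul_add,
          Finset.mul_sum]
        -- The split-off term has no pair behind the first arc, so there the last letter is
        -- necessarily unmatched.
        refine (congrArg₂ (· + ·) ?_ ?_).trans (add_assoc _ _ _).symm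
        · rw [openSum_succ_zero_last]
          dsimp only
          rw [e]
          ring
        · rw [← Finset.sum_add_distrib]
          refine Finset.sum_congr rfl fun x hx => ?_
          rw [Finset.HasAntidiagonal.mem_antidiagonal] at hx
          have := ihm x.2 (by omega) (k + 1) (p + 2 * x.1 + 2) (by rw [hz]; push_cast; omega)
            (fun a ha ha' => h a (by omega) ha')
          rw [openSumTrail] at this
          rw [this]
          ring
    rw [key]
    ring

/-! ### Words centred at the origin and their three-term recursion -/

/-- The letters are at -t, …, t and `t` is removed. The tie with -t is harmless, as peeling needs
only weak maximality. -/
theorem openSum_last_even {s : ℝ} (hs : s ≠ 0) {t k m : ℕ} (h : k + 2 * m + 2 = 2 * t) :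
    openSum s (k + 1) (-t - 1) (m + 1) =
      (s ^ t)⁻¹ * openSum s k (-t - 1) (m + 1) + s ^ t * openSum s (k + 2) (-t - 1) m := by
  rw [openSum_peel_right hs m (k + 1) (-t - 1) t (by push_cast; omega)
    (fun a ha ha' => by rw [Nat.abs_cast, abs_le]; omega), openSumTrail, Nat.abs_cast, zpow_neg,
    zpow_natCast]

theorem openSum_last_even_zero (s : ℝ) {t k : ℕ} (h : k = 2 * t) :
    openSum s (k + 1) (-t - 1) 0 = (s ^ t)⁻¹ * openSum s k (-t - 1) 0 := by
  have e : -(t : ℤ) - 1 + k + 1 = t := by omega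
  rw [openSum_succ_zero_last, e, Nat.abs_cast, zpow_neg, zpow_natCast]

theorem openSum_first_zero {s : ℝ} (hs : s ≠ 0) {t m : ℕ} (h : m + 1 = t) :
    openSum s 0 (-t - 1) (m + 1) = s ^ t * openSum s 1 (-t) m := by
  have e : -(t : ℤ) - 1 + 1 = -t := by omega
  rw [openSum_peel_left hs 0 (-t - 1) m
    (fun a ha ha' => by rw [e, abs_neg, Nat.abs_cast, abs_le]; omega), openSumLead, e, abs_neg,
    Nat.abs_cast, zero_add, zpow_natCast]

/-- The second half of a round: the letters are at -t, …, t - 1, and removing -t leaves a centred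
interval. -/
theorem openSum_first_odd {s : ℝ} (hs : s ≠ 0) {t k m : ℕ} (h : k + 1 + 2 * m + 2 = 2 * t) :
    openSum s (k + 1) (-t - 1) (m + 1) =
      (s ^ t)⁻¹ * openSum s k (-t) (m + 1) + s ^ t * openSum s (k + 2) (-t) m := by
  have e : -(t : ℤ) - 1 + 1 = -t := by omega
  rw [openSum_peel_left hs (k + 1) (-t - 1) m
    (fun a ha ha' => by rw [e, abs_neg, Nat.abs_cast, abs_le]; omega), openSumLead, e, abs_neg,
    Nat.abs_cast, zpow_natCast, zpow_neg, zpow_natCast]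

theorem openSum_first_odd_zero (s : ℝ) (t k : ℕ) :
    openSum s (k + 1) (-t - 1) 0 = (s ^ t)⁻¹ * openSum s k (-t) 0 := by
  have e : -(t : ℤ) - 1 + 1 = -t := by omega
  simp [openSum_succ s k, dyckSum_zero, e]

/-- The sum over the words with letters at `-t, …, t`, of which `2 g + 1` are unmatched. -/
noncomputable def centeredSum (s : ℝ) (t g m : ℕ) : ℝ := openSum s (2 * g + 1) (-t - 1) m

section

variable {s : ℝ} {t g m : ℕ}

theorem neg_succ_cast (t : ℕ) : -((t + 1 : ℕ) : ℤ) = -t - 1 := by push_cast; ring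

theorem centeredSum_zero (s : ℝ) : centeredSum s 0 0 0 = 1 := by
  simp [centeredSum, openSum_succ, openSum_zero, dyckSum_zero]

theorem centeredSum_succ_zero (hs : s ≠ 0) (h : g = t) :
    s ^ (2 * (t + 1)) * centeredSum s (t + 1) (g + 1) 0 = centeredSum s t g 0 := by
  have ha : s ^ (t + 1) ≠ 0 := pow_ne_zero _ hs
  rw [centeredSum, openSum_last_even_zero s (by omega), show 2 * (g + 1) = 2 * g + 1 + 1 by ring,
    openSum_first_odd_zero, neg_succ_cast, ← centeredSum]
  field_simp
  ring

theorem centeredSum_zero_one (hs : s ≠ 0) :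
    centeredSum s 1 0 1 = 2 * centeredSum s 0 0 0 := by
  have h1 := openSum_last_even hs (t := 1) (k := 0) (m := 0) rfl
  have h2 := openSum_first_zero hs (t := 1) (m := 0) rfl
  have h3 := openSum_first_odd_zero s 1 1
  have e : -((1 : ℕ) : ℤ) = -(0 : ℕ) - 1 := by simp
  rw [centeredSum, h1, h2, h3, e, centeredSum]
  field_simp
  ring

theorem centeredSum_zero_add_two (hs : s ≠ 0) (h : m + 1 = t) :
    centeredSum s (t + 1) 0 (m + 2) =
      2 * centeredSum s t 0 (m + 1) + s ^ (2 * (t + 1)) * centeredSum s t 1 m := by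
  have ha : s ^ (t + 1) ≠ 0 := pow_ne_zero _ hs
  have h1 := openSum_last_even hs (t := t + 1) (k := 0) (m := m + 1) (by omega)
  have h2 := openSum_first_zero hs (t := t + 1) (m := m + 1) (by omega)
  have h3 := openSum_first_odd hs (t := t + 1) (k := 1) (m := m) (by omega)
  rw [centeredSum, h1, h2, h3, neg_succ_cast, centeredSum, centeredSum]
  field_simp
  ring

theorem centeredSum_succ_one (hs : s ≠ 0) (h : g + 1 = t) :
    s ^ (2 * (t + 1)) * centeredSum s (t + 1) (g + 1) 1 =
      centeredSum s t g 1 + 2 * s ^ (2 * (t + 1)) * centeredSum s t (g + 1) 0 := by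
  have ha : s ^ (t + 1) ≠ 0 := pow_ne_zero _ hs
  have h1 := openSum_last_even hs (t := t + 1) (k := 2 * (g + 1)) (m := 0) (by omega)
  have h2 := openSum_first_odd hs (t := t + 1) (k := 2 * g + 1) (m := 0) (by omega)
  have h3 := openSum_first_odd_zero s (t + 1) (2 * g + 3)
  rw [centeredSum, h1, show 2 * (g + 1) = 2 * g + 1 + 1 by ring, h2, h3, neg_succ_cast, centeredSum,
    centeredSum]
  field_simp
  ring_nf

/-- The two end letters are both unmatched, one of each kind (in two ways), or both matched when
their turn to be removed comes. Their weights are s ^ (∓(t + 1)), and the powers of s in front clear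
denominators. -/
theorem centeredSum_succ_add_two (hs : s ≠ 0) (h : g + m + 2 = t) :
    s ^ (2 * (t + 1)) * centeredSum s (t + 1) (g + 1) (m + 2) =
      centeredSum s t g (m + 2) + 2 * s ^ (2 * (t + 1)) * centeredSum s t (g + 1) (m + 1) +
        s ^ (4 * (t + 1)) * centeredSum s t (g + 2) m := by
  have ha : s ^ (t + 1) ≠ 0 := pow_ne_zero _ hs
  have h1 := openSum_last_even hs (t := t + 1) (k := 2 * (g + 1)) (m := m + 1) (by omega)
  have h2 := openSum_first_odd hs (t := t + 1) (k := 2 * g + 1) (m := m + 1) (by omega)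
  have h3 := openSum_first_odd hs (t := t + 1) (k := 2 * g + 3) (m := m) (by omega)
  rw [centeredSum, h1, show 2 * (g + 1) = 2 * g + 1 + 1 by ring, h2, h3, neg_succ_cast, centeredSum,
    centeredSum, centeredSum]
  field_simp
  ring_nf

end

/-- Counting letters, 2 t + 1 = 2 g + 1 + 2 m, so `m` is forced. The powers of s ^ 2 turn one
recursion into the other; the separate cases are those where a neighbouring term is missing. -/
theorem transferMoment_mul_pow {s : ℝ} (hs : s ≠ 0) (t g m : ℕ) (h : g + m = t) :
    transferMoment (s ^ 2) t g * (s ^ 2) ^ g.choose 2 = (s ^ 2) ^ (t * g) * centeredSum s t g m := by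
  induction t generalizing g m with
  | zero =>
    obtain ⟨rfl, rfl⟩ : g = 0 ∧ m = 0 := by omega
    simp [transferMoment_zero_zero, centeredSum_zero]
  | succ t ih =>
    have hc1 : ∀ g : ℕ, (g + 1).choose 2 = g.choose 2 + g := fun g => by
      rw [Nat.choose_succ_succ' g 1, Nat.choose_one_right, add_comm]
    rcases g with _ | g
    · rcases m with _ | _ | m
      · omega
      · obtain rfl : t = 0 := by omega
        rw [transferMoment_succ_zero, transferMoment_zero_zero, transferMoment_zero_succ]
        simp [centeredSum_zero_one hs, centeredSum_zero]
      · have h0 := ih 0 (m + 1) (by omega)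
        have h1 := ih 1 m (by omega)
        rw [transferMoment_succ_zero, centeredSum_zero_add_two hs (by omega)]
        simp at h0 h1 ⊢
        linear_combination 2 * h0 + s ^ 2 * h1
    · rw [transferMoment_succ_succ, hc1]
      rcases m with _ | _ | m
      · have h0 := ih g 0 (by omega)
        have hF := centeredSum_succ_zero (g := g) (t := t) hs (by omega)
        rw [transferMoment_eq_zero (g := g + 2) _ (by omega),
          transferMoment_eq_zero (g := g + 1) _ (by omega)]
        linear_combination s ^ (2 * g) * h0 - s ^ (2 * (t + 1) * g) * hF
      · have h0 := ih g 1 (by omega)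
        have h1 := ih (g + 1) 0 (by omega)
        have hF := centeredSum_succ_one (g := g) (t := t) hs (by omega)
        rw [hc1] at h1
        rw [transferMoment_eq_zero (g := g + 2) _ (by omega)]
        linear_combination s ^ (2 * g) * h0 + 2 * s ^ (2 * (g + 1)) * h1 -
          s ^ (2 * (t + 1) * g) * hF
      · have h0 := ih g (m + 2) (by omega)
        have h1 := ih (g + 1) (m + 1) (by omega)
        have h2 := ih (g + 2) m (by omega)
        have hF := centeredSum_succ_add_two (g := g) (t := t) (m := m) hs (by omega)
        rw [hc1, hc1] at h2
        rw [hc1] at h1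
        linear_combination s ^ (2 * g) * h0 + 2 * s ^ (2 * (g + 1)) * h1 +
          s ^ (2 * (g + 2)) * h2 - s ^ (2 * (t + 1) * g) * hF

/-- The sum over all balanced words with letters at `-t, …, t + 1`. -/
theorem dyckSum_centered {s : ℝ} (hs : s ≠ 0) (t : ℕ) :
    dyckSum s (t + 1) (-t - 1) = s ^ (t + 1) * transferMoment (s ^ 2) t 0 := by
  have h1 := openSum_peel_right hs t 0 (-t - 1) (t + 1) (by push_cast; ring)
    (fun a ha ha' => by rw [abs_of_nonneg (a := (t : ℤ) + 1) (by omega), abs_le]; omega)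
  have h2 := transferMoment_mul_pow hs t 0 t (by omega)
  rw [openSum_zero, openSumTrail, zero_add, abs_of_nonneg (by omega)] at h1
  simp [centeredSum] at h2
  rw [h1, h2]
  norm_cast

/-! ### Crossings of 321-avoiding permutations -/

/-- As many positions as letters are at most `k`. -/
theorem card_arcs_over_gap {n : ℕ} (σ : S n) (k : Fin n) :
    (Finset.univ.filter fun i => i ≤ k ∧ k < σ i).card =
      (Finset.univ.filter fun j => σ j ≤ k ∧ k < j).card := by
  have h1 : (Finset.univ.filter fun i => i ≤ k).card = (Finset.univ.filter fun i => σ i ≤ k).card :=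
    (Finset.card_equiv σ (by simp)).symm
  have h2 := Finset.card_filter_add_card_filter_not (s := Finset.univ.filter fun i => i ≤ k)
    (fun i => σ i ≤ k)
  have h3 := Finset.card_filter_add_card_filter_not (s := Finset.univ.filter fun i => σ i ≤ k)
    (fun i => i ≤ k)
  simp only [Finset.filter_filter, not_le] at h2 h3
  have e3 : (Finset.univ.filter fun i => i ≤ k ∧ σ i ≤ k) =
      Finset.univ.filter fun i => σ i ≤ k ∧ i ≤ k := by
    simp only [and_comm]
  rw [e3] at h2
  omega

theorem exists_arc_over_gap {n : ℕ} (σ : S n) (k : Fin n) :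
    (∃ i, i ≤ k ∧ k < σ i) ↔ ∃ j, σ j ≤ k ∧ k < j := by
  have h := card_arcs_over_gap σ k
  have h1 : (∃ i, i ≤ k ∧ k < σ i) ↔ 0 < (Finset.univ.filter fun i => i ≤ k ∧ k < σ i).card := by
    rw [Finset.card_pos]; simp [Finset.Nonempty]
  have h2 : (∃ j, σ j ≤ k ∧ k < j) ↔ 0 < (Finset.univ.filter fun j => σ j ≤ k ∧ k < j).card := by
    rw [Finset.card_pos]; simp [Finset.Nonempty]
  rw [h1, h2, h]

/-- An anti-excedance is not a left-to-right maximum. -/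
theorem exists_inversion_of_lt {n : ℕ} (σ : S n) {k : Fin n} (h : σ k < k) :
    ∃ i < k, σ k < σ i := by
  obtain ⟨i, hi, hi'⟩ := (exists_arc_over_gap σ (σ k)).2 ⟨k, le_rfl, h⟩
  exact ⟨i, hi.trans_lt h, hi'⟩

theorem crs_eq_sum {n : ℕ} (σ : S n) : crs n σ =
    ∑ k, ((Finset.univ.filter fun i => i < k ∧ k < σ i ∧ σ i < σ k).card +
      (Finset.univ.filter fun j => σ k < σ j ∧ σ j ≤ k ∧ k < j).card) := by
  rw [Finset.sum_add_distrib, ← Finset.card_sigma, ← Finset.card_sigma]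
  have e1 : (Finset.univ.sigma fun k => Finset.univ.filter fun i => i < k ∧ k < σ i ∧ σ i < σ k).card
      = (Finset.univ.filter fun p : Fin n × Fin n => p.1 < p.2 ∧ p.2 < σ p.1 ∧ σ p.1 < σ p.2).card :=
    Finset.card_equiv ((Equiv.sigmaEquivProd _ _).trans (Equiv.prodComm _ _)) fun ⟨f, j⟩ => by
      simp [Equiv.sigmaEquivProd]
  have e2 : (Finset.univ.sigma fun k => Finset.univ.filter fun j => σ k < σ j ∧ σ j ≤ k ∧ k < j).card
      = (Finset.univ.filter fun p : Fin n × Fin n =>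
        σ p.1 < σ p.2 ∧ σ p.2 ≤ p.1 ∧ p.1 < p.2).card :=
    Finset.card_equiv (Equiv.sigmaEquivProd _ _) fun ⟨f, j⟩ => by
      simp [Equiv.sigmaEquivProd]
  rw [e1, e2, ← Finset.card_union_of_disjoint, crs]
  · congr 1
    ext ⟨i, j⟩
    rw [Finset.mem_filter_univ]
    simp only [IsCrossing, Finset.mem_union, Finset.mem_filter_univ]
  · rw [Finset.disjoint_left]
    simp only [Finset.mem_filter_univ]
    grind

/-- Charge an upper crossing to its right point and a lower one to its left point. If σ k > k,
avoidance makes every upper arc over `k` cross the arc of `k`. If σ k < k, the same holds for lower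
arcs over the gap after `k`, as numerous as the upper ones. Over a fixed point there is no arc,
since one in each direction would form 321. -/
theorem crs_of_not_containsThree_p321 {n : ℕ} {σ : S n} (hσ : ¬ ContainsThree p321 σ) :
    crs n σ = ∑ k, (Finset.univ.filter fun i => i < k ∧ k < σ i).card := by
  rw [containsThree_p321] at hσ
  push Not at hσ
  rw [crs_eq_sum]
  refine Finset.sum_congr rfl fun k _ => ?_
  rcases lt_trichotomy (σ k) k with hk | hk | hk
  · obtain ⟨i, hik, hi⟩ := exists_inversion_of_lt σ hk
    have e1 : (Finset.univ.filter fun i => i < k ∧ k < σ i ∧ σ i < σ k) = ∅ := by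
      ext i; simp only [Finset.mem_filter_univ, Finset.notMem_empty]; grind
    have e2 : (Finset.univ.filter fun j => σ k < σ j ∧ σ j ≤ k ∧ k < j) =
        Finset.univ.filter fun j => σ j ≤ k ∧ k < j := by
      ext j
      have h1 := hσ i k j hik
      have h2 : k < j → σ j ≠ σ k := fun h h' => h.ne' (σ.injective h')
      simp only [Finset.mem_filter_univ]; grind
    have e3 : (Finset.univ.filter fun i => i < k ∧ k < σ i) =
        Finset.univ.filter fun i => i ≤ k ∧ k < σ i := by
      ext j; simp only [Finset.mem_filter_univ]; grind
    rw [e1, e2, e3, card_arcs_over_gap, Finset.card_empty, zero_add]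
  · have e1 : (Finset.univ.filter fun i => i < k ∧ k < σ i ∧ σ i < σ k) = ∅ := by
      ext i; simp only [Finset.mem_filter_univ, Finset.notMem_empty]; grind
    have e2 : (Finset.univ.filter fun j => σ k < σ j ∧ σ j ≤ k ∧ k < j) = ∅ := by
      ext i; simp only [Finset.mem_filter_univ, Finset.notMem_empty]; grind
    have e3 : (Finset.univ.filter fun i => i < k ∧ k < σ i) = ∅ := by
      ext i
      simp only [Finset.mem_filter_univ, Finset.notMem_empty, iff_false]
      rintro ⟨h1, h2⟩
      obtain ⟨j, hj, hj'⟩ := (exists_arc_over_gap σ k).1 ⟨i, h1.le, h2⟩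
      have h3 : σ j ≠ σ k := fun h' => hj'.ne' (σ.injective h')
      have := hσ i k j h1 hj'
      grind
    rw [e1, e2, e3]; rfl
  · have e1 : (Finset.univ.filter fun i => i < k ∧ k < σ i ∧ σ i < σ k) =
        Finset.univ.filter fun i => i < k ∧ k < σ i := by
      ext i
      simp only [Finset.mem_filter_univ]
      refine ⟨fun h => ⟨h.1, h.2.1⟩, fun h => ⟨h.1, h.2, ?_⟩⟩
      obtain ⟨j, hj, hj'⟩ := (exists_arc_over_gap σ k).1 ⟨k, le_rfl, hk⟩
      have h3 : σ i ≠ σ k := fun h' => h.1.ne (σ.injective h')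
      have := hσ i k j h.1 hj'
      grind
    have e2 : (Finset.univ.filter fun j => σ k < σ j ∧ σ j ≤ k ∧ k < j) = ∅ := by
      ext i; simp only [Finset.mem_filter_univ, Finset.notMem_empty]; grind
    rw [e1, e2]; rfl

/-! ### The generating tree of 321-avoiding permutations -/

/-- The number of pairs `(k, j)` with `σ j < k < j`. -/
def lowerArea {n : ℕ} (σ : S n) : ℕ := ∑ j : Fin n, (j.val - (σ j).val - 1)

theorem crs_inv_of_not_containsThree_p321 {n : ℕ} {σ : S n} (hσ : ¬ ContainsThree p321 σ) :
    crs n σ⁻¹ = lowerArea σ := by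
  rw [crs_of_not_containsThree_p321 (by rwa [containsThree_p321_inv]), lowerArea,
    ← Finset.card_sigma]
  have : ∀ j : Fin n, j.val - (σ j).val - 1 = (Finset.Ioo (σ j) j).card := fun j => by
    rw [Fin.card_Ioo]
  simp only [this]
  rw [← Finset.card_sigma]
  refine Finset.card_bij' (fun x _ => ⟨σ⁻¹ x.2, x.1⟩) (fun x _ => ⟨x.2, σ x.1⟩) ?_ ?_ ?_ ?_ <;>
    simp

/-- The permutation `σ` with a last letter `v` appended. -/
noncomputable def snocPerm {n : ℕ} (σ : S n) (v : Fin (n + 1)) : S (n + 1) :=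
  Equiv.ofBijective (Fin.snoc (α := fun _ => Fin (n + 1)) (fun i => v.succAbove (σ i)) v) <| by
    rw [← Finite.injective_iff_bijective]
    intro a b
    induction a using Fin.lastCases <;> induction b using Fin.lastCases <;>
      simp [Fin.succAbove_ne, (Fin.succAbove_ne _ _).symm]

theorem snocPerm_castSucc {n : ℕ} (σ : S n) (v : Fin (n + 1)) (i : Fin n) :
    snocPerm σ v i.castSucc = v.succAbove (σ i) := by
  simp [snocPerm]

theorem snocPerm_last {n : ℕ} (σ : S n) (v : Fin (n + 1)) : snocPerm σ v (Fin.last n) = v := by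
  simp [snocPerm]

theorem snocPerm_bijective (n : ℕ) :
    Function.Bijective fun x : S n × Fin (n + 1) => snocPerm x.1 x.2 := by
  rw [Fintype.bijective_iff_injective_and_card]
  constructor
  · rintro ⟨σ, v⟩ ⟨τ, w⟩ h
    dsimp only at h
    have hv : v = w := by rw [← snocPerm_last σ v, h, snocPerm_last]
    subst hv
    congr 1
    ext i
    have := snocPerm_castSucc σ v i
    rw [h, snocPerm_castSucc] at this
    rw [Fin.succAbove_right_injective this]
  · simp [Fintype.card_perm, Nat.factorial_succ, mul_comm]

/-- The least letter that exceeds all letters `σ b` of inversions `σ a > σ b`, `a < b`. -/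
def inversionBound {n : ℕ} (σ : S n) : ℕ :=
  (Finset.univ.filter fun p : Fin n × Fin n => p.1 < p.2 ∧ σ p.2 < σ p.1).sup fun p =>
    (σ p.2).val + 1

theorem lt_inversionBound {n : ℕ} (σ : S n) (x : ℕ) :
    x < inversionBound σ ↔ ∃ a b, a < b ∧ σ b < σ a ∧ x ≤ σ b := by
  simp [inversionBound, Finset.lt_sup_iff, and_assoc]

theorem inversionBound_le {n : ℕ} (σ : S n) : inversionBound σ ≤ n := by
  by_contra! h
  obtain ⟨a, b, -, -, h⟩ := (lt_inversionBound σ n).1 h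
  omega

theorem val_succAbove {n : ℕ} (v : Fin (n + 1)) (i : Fin n) :
    (v.succAbove i).val = if i.val < v.val then i.val else i.val + 1 := by
  rw [Fin.succAbove]
  simp only [Fin.lt_def, Fin.val_castSucc]
  split_ifs <;> simp

/-- A new occurrence must use the appended letter as its last and smallest, below an inversion. -/
theorem containsThree_p321_snocPerm {n : ℕ} (σ : S n) (v : Fin (n + 1)) :
    ContainsThree p321 (snocPerm σ v) ↔ ContainsThree p321 σ ∨ v.val < inversionBound σ := by
  rw [containsThree_p321, containsThree_p321, lt_inversionBound]
  constructor
  · rintro ⟨a, b, c, h1, h2, h3, h4⟩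
    induction b using Fin.lastCases with
    | last => exact absurd h2 (Fin.le_last c).not_gt
    | cast b =>
    induction a using Fin.lastCases with
    | last => exact absurd (h1.trans h2) (Fin.le_last c).not_gt
    | cast a =>
    rw [snocPerm_castSucc, snocPerm_castSucc] at h4
    rw [Fin.succAbove_lt_succAbove_iff] at h4
    induction c using Fin.lastCases with
    | last =>
      rw [snocPerm_last, snocPerm_castSucc, Fin.lt_def, val_succAbove] at h3
      exact Or.inr ⟨a, b, h1, h4, by split_ifs at h3 <;> omega⟩
    | cast c =>
      rw [snocPerm_castSucc, snocPerm_castSucc, Fin.succAbove_lt_succAbove_iff] at h3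
      exact Or.inl ⟨a, b, c, h1, h2, h3, h4⟩
  · rintro (⟨a, b, c, h1, h2, h3, h4⟩ | ⟨a, b, h1, h2, h3⟩)
    · refine ⟨a.castSucc, b.castSucc, c.castSucc, h1, h2, ?_⟩
      simpa [snocPerm_castSucc, Fin.succAbove_lt_succAbove_iff] using ⟨h3, h4⟩
    · refine ⟨a.castSucc, b.castSucc, Fin.last n, h1, Fin.castSucc_lt_last b, ?_, ?_⟩
      · rw [snocPerm_castSucc, snocPerm_last, Fin.lt_def, val_succAbove]
        split_ifs <;> omega
      · simpa [snocPerm_castSucc, Fin.succAbove_lt_succAbove_iff] using h2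

theorem inversionBound_snocPerm {n : ℕ} (σ : S n) (v : Fin (n + 1))
    (hv : inversionBound σ ≤ v) : inversionBound (snocPerm σ v) =
      if v.val < n then v.val + 1 else inversionBound σ := by
  refine eq_of_forall_lt_iff fun x => ?_
  have hold : ∀ a b, a < b → σ b < σ a → ((v.succAbove (σ b)).val = σ b) := fun a b h h' => by
    have := (lt_inversionBound σ (σ b)).2 ⟨a, b, h, h', le_rfl⟩
    rw [val_succAbove, if_pos (by omega)]
  have key : x < inversionBound (snocPerm σ v) ↔ x < inversionBound σ ∨ (v.val < n ∧ x ≤ v) := by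
    rw [lt_inversionBound, lt_inversionBound]
    constructor
    · rintro ⟨a, b, h1, h2, h3⟩
      induction a using Fin.lastCases with
      | last => exact absurd h1 (Fin.le_last b).not_gt
      | cast a =>
      induction b using Fin.lastCases with
      | last =>
        rw [snocPerm_last] at h2 h3
        rw [snocPerm_castSucc, Fin.lt_def, val_succAbove] at h2
        refine Or.inr ⟨?_, h3⟩
        have := (σ a).isLt
        split_ifs at h2 <;> omega
      | cast b =>
        rw [snocPerm_castSucc, snocPerm_castSucc, Fin.succAbove_lt_succAbove_iff] at h2
        rw [snocPerm_castSucc, hold a b h1 h2] at h3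
        exact Or.inl ⟨a, b, h1, h2, h3⟩
    · rintro (⟨a, b, h1, h2, h3⟩ | ⟨h1, h2⟩)
      · refine ⟨a.castSucc, b.castSucc, h1, ?_, ?_⟩
        · simpa [snocPerm_castSucc, Fin.succAbove_lt_succAbove_iff] using h2
        · rwa [snocPerm_castSucc, hold a b h1 h2]
      -- The old letter `v` is raised to `v + 1` and forms an inversion with the new last letter.
      · refine ⟨(σ⁻¹ ⟨v, h1⟩).castSucc, Fin.last n, Fin.castSucc_lt_last _, ?_, ?_⟩
        · rw [snocPerm_castSucc, snocPerm_last, Fin.lt_def, val_succAbove]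
          simp
        · rwa [snocPerm_last]
  rw [key]
  split_ifs <;> omega

/-- A letter σ i < i is the lower end of an inversion, so it lies below the bound and is not raised.
The other letters contribute 0 by truncated subtraction even if raised. -/
theorem lowerArea_snocPerm {n : ℕ} (σ : S n) (v : Fin (n + 1))
    (hv : inversionBound σ ≤ v) : lowerArea (snocPerm σ v) = lowerArea σ + (n - 1 - v) := by
  rw [lowerArea, Fin.sum_univ_castSucc, lowerArea]
  congr 1
  · refine Finset.sum_congr rfl fun i _ => ?_
    rw [snocPerm_castSucc, val_succAbove, Fin.val_castSucc]
    rcases lt_or_ge (σ i) i with h | h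
    · obtain ⟨a, ha, ha'⟩ := exists_inversion_of_lt σ h
      have := (lt_inversionBound σ (σ i)).2 ⟨a, i, ha, ha', le_rfl⟩
      rw [if_pos (by omega)]
    · rw [Fin.le_def] at h
      split_ifs <;> omega
  · rw [snocPerm_last, Fin.val_last]
    omega

/-- The sum over the 321-avoiding permutations, weighted by `lowerArea` and by a function of
`n - inversionBound`. -/
noncomputable def areaSum (q : ℝ) (n : ℕ) (f : ℕ → ℝ) : ℝ :=
  ∑ σ : S n, if ContainsThree p321 σ then 0 else q ^ lowerArea σ * f (n - inversionBound σ)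

theorem areaSum_zero (q : ℝ) (f : ℕ → ℝ) : areaSum q 0 f = f 0 := by
  have : ¬ ContainsThree p321 (1 : S 0) := by
    rintro ⟨a, -⟩; exact a.elim0
  simp [areaSum, this, lowerArea]

theorem areaSum_succ (q : ℝ) (n : ℕ) (f : ℕ → ℝ) : areaSum q (n + 1) f =
    areaSum q n fun b => f (b + 1) + ∑ i ∈ Finset.range b, q ^ i * f (i + 1) := by
  rw [areaSum, ← (Equiv.ofBijective _ (snocPerm_bijective n)).sum_comp, Fintype.sum_prod_type,
    areaSum]
  refine Finset.sum_congr rfl fun σ _ => ?_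
  simp only [Equiv.ofBijective_apply, containsThree_p321_snocPerm]
  by_cases hσ : ContainsThree p321 σ
  · simp [hσ]
  simp only [hσ, false_or, if_false]
  have hle := inversionBound_le σ
  have e : ∀ v : Fin (n + 1), (if v.val < inversionBound σ then 0 else
      q ^ lowerArea (snocPerm σ v) * f (n + 1 - inversionBound (snocPerm σ v))) =
      if v.val < inversionBound σ then 0 else
      q ^ lowerArea σ * (q ^ (n - 1 - v.val) * f (n + 1 - if v.val < n then v.val + 1 else
        inversionBound σ)) := fun v => by
    split_ifs with h h1
    · rfl
    all_goals rw [lowerArea_snocPerm σ v (by omega), inversionBound_snocPerm σ v (by omega), pow_add,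
        mul_assoc]; simp [h1]
  rw [Finset.sum_congr rfl fun v _ => e v, Fin.sum_univ_castSucc]
  simp only [Fin.val_castSucc, Fin.is_lt, if_true, Fin.val_last, lt_irrefl, if_false]
  -- Reflecting the sum puts v = n - 1 - i: the area grows by i and the new label is i + 1. The
  -- letter v = n gives the term without a factor.
  rw [if_neg (by omega), Fin.sum_univ_eq_sum_range (fun v => if v < inversionBound σ then (0 : ℝ) else
    q ^ lowerArea σ * (q ^ (n - 1 - v) * f (n + 1 - (v + 1)))) n, ← Finset.sum_range_reflect]
  have e2 : ∀ i ∈ Finset.range n, (if n - 1 - i < inversionBound σ then (0 : ℝ) else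
      q ^ lowerArea σ * (q ^ (n - 1 - (n - 1 - i)) * f (n + 1 - (n - 1 - i + 1)))) =
      if i < n - inversionBound σ then q ^ lowerArea σ * (q ^ i * f (i + 1)) else 0 := by
    intro i hi
    rw [Finset.mem_range] at hi
    by_cases h : i < n - inversionBound σ
    · rw [if_neg (by omega), if_pos h, show n - 1 - (n - 1 - i) = i by omega,
        show n + 1 - (n - 1 - i + 1) = i + 1 by omega]
    · rw [if_pos (by omega), if_neg h]
  rw [Finset.sum_congr rfl e2, ← Finset.sum_filter, mul_add, Finset.mul_sum, add_comm]
  congr 1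
  · rw [show n + 1 - inversionBound σ = n - inversionBound σ + 1 by omega]
    simp
  · refine Finset.sum_congr ?_ fun _ _ => rfl
    ext i
    simp only [Finset.mem_filter, Finset.mem_range]
    omega

/-- Shifting the label by one turns the recursion of `areaSum_succ` into `transfer`. -/
theorem areaSum_eq_transfer (q : ℝ) (t : ℕ) (f : ℕ → ℝ) :
    areaSum q (t + 1) f = (transfer q ^ t) (fun b => f (b + 1)) 0 := by
  induction t generalizing f with
  | zero => simp [areaSum_succ, areaSum_zero]
  | succ t ih =>
    rw [areaSum_succ, ih, pow_succ, Module.End.mul_apply]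
    rfl

theorem sum_pow_crs_p321 (q : ℝ) (t : ℕ) :
    ∑ σ ∈ avoiders {⟨3, p321⟩} (t + 1), q ^ crs (t + 1) σ = transferMoment q t 0 := by
  have h := areaSum_eq_transfer q t fun _ => 1
  rw [transferMoment]
  simp only [qBinom_zero_right]
  rw [← h, areaSum, avoiders_eq_filter, Finset.sum_filter, ← Equiv.sum_comp (Equiv.inv (S (t + 1)))]
  refine Finset.sum_congr rfl fun σ _ => ?_
  simp only [Equiv.inv_apply, containsThree_p321_inv, mul_one, ite_not]
  split_ifs with hσ
  · rfl
  · rw [crs_inv_of_not_containsThree_p321 hσ]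

/-! ### Crossings of 132-avoiding permutations -/

/-- Crossing of two points of the plane, each a position and a letter. -/
def CrossPts (x y : ℤ × ℤ) : Prop :=
  (x.1 < y.1 ∧ y.1 < x.2 ∧ x.2 < y.2) ∨ (x.2 < y.2 ∧ y.2 ≤ x.1 ∧ x.1 < y.1)

instance (x y : ℤ × ℤ) : Decidable (CrossPts x y) := by unfold CrossPts; infer_instance

/-- The number of crossings of a set of points. -/
def crsPts (A : Finset (ℤ × ℤ)) : ℕ := ((A ×ˢ A).filter fun z => CrossPts z.1 z.2).card

/-- `A` is the graph of a 132-avoiding bijection from `[p, p + n)` to `[v, v + n)`. -/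
structure IsConfig (p v : ℤ) (n : ℕ) (A : Finset (ℤ × ℤ)) : Prop where
  bounds : ∀ x ∈ A, p ≤ x.1 ∧ x.1 < p + n ∧ v ≤ x.2 ∧ x.2 < v + n
  card : A.card = n
  fst_inj : ∀ x ∈ A, ∀ y ∈ A, x.1 = y.1 → x = y
  snd_inj : ∀ x ∈ A, ∀ y ∈ A, x.2 = y.2 → x = y
  avoid : ∀ x ∈ A, ∀ y ∈ A, ∀ z ∈ A, x.1 < y.1 → y.1 < z.1 → x.2 < z.2 → z.2 < y.2 → False

namespace IsConfig

variable {p v : ℤ} {n l m : ℕ} {A L R : Finset (ℤ × ℤ)}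

theorem image_fst (h : IsConfig p v n A) : A.image Prod.fst = Finset.Ico p (p + n) := by
  refine Finset.eq_of_subset_of_card_le ?_ ?_
  · intro i hi
    obtain ⟨x, hx, rfl⟩ := Finset.mem_image.1 hi
    have := h.bounds x hx
    simp; omega
  · rw [Finset.card_image_of_injOn (fun x hx y hy e => h.fst_inj x hx y hy e), h.card]
    simp

theorem image_snd (h : IsConfig p v n A) : A.image Prod.snd = Finset.Ico v (v + n) := by
  refine Finset.eq_of_subset_of_card_le ?_ ?_
  · intro i hi
    obtain ⟨x, hx, rfl⟩ := Finset.mem_image.1 hi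
    have := h.bounds x hx
    simp; omega
  · rw [Finset.card_image_of_injOn (fun x hx y hy e => h.snd_inj x hx y hy e), h.card]
    simp

theorem exists_fst (h : IsConfig p v n A) {i : ℤ} (h1 : p ≤ i) (h2 : i < p + n) :
    ∃ x ∈ A, x.1 = i := by
  have : i ∈ A.image Prod.fst := by rw [h.image_fst]; simp; omega
  simpa using this

theorem exists_snd (h : IsConfig p v n A) {i : ℤ} (h1 : v ≤ i) (h2 : i < v + n) :
    ∃ x ∈ A, x.2 = i := by
  have : i ∈ A.image Prod.snd := by rw [h.image_snd]; simp; omega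
  simpa using this

theorem card_filter_snd (h : IsConfig p v n A) (c : ℤ) :
    (A.filter fun x => c < x.2).card = ((Finset.Ico v (v + n)).filter fun a => c < a).card := by
  rw [← h.image_snd, Finset.filter_image, Finset.card_image_of_injOn]
  exact fun x hx y hy e => h.snd_inj x (Finset.mem_filter.1 hx).1 y (Finset.mem_filter.1 hy).1 e

theorem card_filter_fst (h : IsConfig p v n A) (P : ℤ → Prop) [DecidablePred P] :
    (A.filter fun x => P x.1).card = ((Finset.Ico p (p + n)).filter P).card := by
  rw [← h.image_fst, Finset.filter_image, Finset.card_image_of_injOn]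
  exact fun x hx y hy e => h.fst_inj x (Finset.mem_filter.1 hx).1 y (Finset.mem_filter.1 hy).1 e

end IsConfig

/-- The configuration with greatest letter at `(p + l, v + l + m)`, left part `L` and right part
`R`. -/
def joinPts (p v : ℤ) (l m : ℕ) (L R : Finset (ℤ × ℤ)) : Finset (ℤ × ℤ) :=
  insert (p + l, v + l + m) (L ∪ R)

theorem mem_joinPts {p v : ℤ} {l m : ℕ} {L R : Finset (ℤ × ℤ)} {x : ℤ × ℤ} :
    x ∈ joinPts p v l m L R ↔ x = (p + l, v + l + m) ∨ x ∈ L ∨ x ∈ R := by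
  simp [joinPts]

theorem IsConfig.join {p v : ℤ} {l m : ℕ} {L R : Finset (ℤ × ℤ)} (hL : IsConfig p (v + m) l L)
    (hR : IsConfig (p + l + 1) v m R) : IsConfig p v (l + m + 1) (joinPts p v l m L R) where
  bounds := by
    intro x hx
    rcases mem_joinPts.1 hx with rfl | hx | hx
    · simp; omega
    · have := hL.bounds x hx; push_cast; omega
    · have := hR.bounds x hx; push_cast; omega
  card := by
    rw [joinPts, Finset.card_insert_of_notMem, Finset.card_union_of_disjoint, hL.card, hR.card]
    · rw [Finset.disjoint_left]
      intro x hx hx'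
      have := hL.bounds x hx
      have := hR.bounds x hx'
      omega
    · rw [Finset.mem_union]
      rintro (h | h)
      · have := hL.bounds _ h; simp at this
      · have := hR.bounds _ h; simp at this
  fst_inj := by
    intro x hx y hy e
    rcases mem_joinPts.1 hx with rfl | hx | hx <;> rcases mem_joinPts.1 hy with rfl | hy | hy
    · rfl
    · have := hL.bounds y hy; simp at e; omega
    · have := hR.bounds y hy; simp at e; omega
    · have := hL.bounds x hx; simp at e; omega
    · exact hL.fst_inj x hx y hy e
    · have := hL.bounds x hx; have := hR.bounds y hy; omega
    · have := hR.bounds x hx; simp at e; omega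
    · have := hR.bounds x hx; have := hL.bounds y hy; omega
    · exact hR.fst_inj x hx y hy e
  snd_inj := by
    intro x hx y hy e
    rcases mem_joinPts.1 hx with rfl | hx | hx <;> rcases mem_joinPts.1 hy with rfl | hy | hy
    · rfl
    · have := hL.bounds y hy; simp at e; omega
    · have := hR.bounds y hy; simp at e; omega
    · have := hL.bounds x hx; simp at e; omega
    · exact hL.snd_inj x hx y hy e
    · have := hL.bounds x hx; have := hR.bounds y hy; omega
    · have := hR.bounds x hx; simp at e; omega
    · have := hR.bounds x hx; have := hL.bounds y hy; omega
    · exact hR.snd_inj x hx y hy e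
  avoid := by
    intro x hx y hy z hz h1 h2 h3 h4
    have hbd : ∀ w ∈ joinPts p v l m L R, (w.1 < p + l ∧ v + m ≤ w.2 ∧ w.2 < v + l + m ∧ w ∈ L) ∨
        (w.1 = p + l ∧ w.2 = v + l + m) ∨ (p + l < w.1 ∧ w.2 < v + m ∧ w ∈ R) := by
      intro w hw
      rcases mem_joinPts.1 hw with rfl | hw | hw
      · simp
      · have := hL.bounds w hw
        exact Or.inl ⟨by omega, by omega, by omega, hw⟩
      · have := hR.bounds w hw
        exact Or.inr (Or.inr ⟨by omega, by omega, hw⟩)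
    rcases hbd x hx with hx | hx | hx
    · rcases hbd z hz with hz | hz | hz
      · rcases hbd y hy with hy | hy | hy
        · exact hL.avoid x hx.2.2.2 y hy.2.2.2 z hz.2.2.2 h1 h2 h3 h4
        all_goals omega
      · rcases hbd y hy with hy | hy | hy <;> omega
      · omega
    · rcases hbd z hz with hz | hz | hz <;> omega
    · rcases hbd y hy with hy | hy | hy
      · omega
      · omega
      · rcases hbd z hz with hz | hz | hz
        · omega
        · omega
        · exact hR.avoid x hx.2.2 y hy.2.2 z hz.2.2 h1 h2 h3 h4

theorem IsConfig.exists_join {p v : ℤ} {n : ℕ} {A : Finset (ℤ × ℤ)} (h : IsConfig p v (n + 1) A) :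
    ∃ l m L R, l + m = n ∧ IsConfig p (v + m) l L ∧ IsConfig (p + l + 1) v m R ∧
      A = joinPts p v l m L R := by
  obtain ⟨⟨j, w⟩, htop, hw⟩ := h.exists_snd (i := v + n) (by omega) (by push_cast; omega)
  obtain rfl : w = v + n := hw
  have hj := h.bounds _ htop
  dsimp only at hj
  push_cast at hj
  obtain ⟨l, hl⟩ : ∃ l : ℕ, j = p + l := ⟨(j - p).toNat, by omega⟩
  obtain ⟨m, hm⟩ : ∃ m : ℕ, l + m = n := ⟨n - l, by omega⟩
  subst hl
  have hv : v + (n : ℤ) = v + l + m := by rw [← hm]; push_cast; ring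
  rw [hv] at htop
  have htop' : ∀ x ∈ A, x.1 ≠ p + l → x.2 < v + l + m := fun x hx hne => by
    have h1 := h.bounds x hx
    have h2 : x.2 ≠ v + l + m := fun e => hne (by rw [h.snd_inj x hx _ htop e])
    push_cast at h1
    omega
  -- Otherwise `x`, the greatest letter and `y` would form 132.
  have hsep : ∀ x ∈ A, ∀ y ∈ A, x.1 < p + l → p + l < y.1 → y.2 < x.2 := fun x hx y hy h1 h2 => by
    have h3 := h.avoid x hx _ htop y hy h1 h2
    have h4 := htop' y hy h2.ne'
    have h5 : x.2 ≠ y.2 := fun e => by have := h.snd_inj x hx y hy e; subst this; omega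
    by_contra h6
    exact h3 (by omega) h4
  set L := A.filter fun x => x.1 < p + l with hLdef
  set R := A.filter fun x => p + l < x.1 with hRdef
  have hLc : L.card = l := by
    rw [hLdef, h.card_filter_fst (fun i => i < p + l), Finset.Ico_filter_lt, Int.card_Ico]
    push_cast
    omega
  have hRc : R.card = m := by
    rw [hRdef, h.card_filter_fst (fun i => p + l < i)]
    have : (Finset.Ico p (p + ((n + 1 : ℕ) : ℤ))).filter (fun i => p + l < i) =
        Finset.Ico (p + l + 1) (p + n + 1) := by
      ext i; simp; omega
    rw [this, Int.card_Ico]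
    omega
  have hL : ∀ x ∈ L, x ∈ A ∧ x.1 < p + l := fun x hx => by simpa [hLdef] using hx
  have hR : ∀ x ∈ R, x ∈ A ∧ p + l < x.1 := fun x hx => by simpa [hRdef] using hx
  refine ⟨l, m, L, R, hm, ⟨fun x hx => ?_, hLc, fun x hx y hy => ?_, fun x hx y hy => ?_,
    fun x hx y hy z hz => ?_⟩, ⟨fun y hy => ?_, hRc, fun x hx y hy => ?_, fun x hx y hy => ?_,
    fun x hx y hy z hz => ?_⟩, ?_⟩
  · obtain ⟨hxA, hx1⟩ := hL x hx
    have h1 := h.bounds x hxA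
    have h2 := htop' x hxA hx1.ne
    -- All `m` letters of `R` lie between `v` and the letter of `x`, which is therefore at least `v
    -- + m`.
    have h3 : (R.image Prod.snd).card ≤ (Finset.Ico v x.2).card := Finset.card_le_card fun i hi => by
      obtain ⟨y, hy, rfl⟩ := Finset.mem_image.1 hi
      obtain ⟨hyA, hy1⟩ := hR y hy
      have h4 := hsep x hxA y hyA hx1 hy1
      have h5 := h.bounds y hyA
      simp; omega
    rw [Finset.card_image_of_injOn (fun x hx y hy e => h.snd_inj x (hR x hx).1 y (hR y hy).1 e),
      hRc, Int.card_Ico] at h3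
    omega
  · exact h.fst_inj x (hL x hx).1 y (hL y hy).1
  · exact h.snd_inj x (hL x hx).1 y (hL y hy).1
  · exact h.avoid x (hL x hx).1 y (hL y hy).1 z (hL z hz).1
  · obtain ⟨hyA, hy1⟩ := hR y hy
    have h1 := h.bounds y hyA
    have h2 := htop' y hyA hy1.ne'
    have h3 : (L.image Prod.snd).card ≤ (Finset.Ico (y.2 + 1) (v + l + m)).card :=
      Finset.card_le_card fun i hi => by
        obtain ⟨x, hx, rfl⟩ := Finset.mem_image.1 hi
        obtain ⟨hxA, hx1⟩ := hL x hx
        have h4 := hsep x hxA y hyA hx1 hy1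
        have h5 := htop' x hxA hx1.ne
        simp; omega
    rw [Finset.card_image_of_injOn (fun x hx y hy e => h.snd_inj x (hL x hx).1 y (hL y hy).1 e),
      hLc, Int.card_Ico] at h3
    push_cast at h1
    omega
  · exact h.fst_inj x (hR x hx).1 y (hR y hy).1
  · exact h.snd_inj x (hR x hx).1 y (hR y hy).1
  · exact h.avoid x (hR x hx).1 y (hR y hy).1 z (hR z hz).1
  · ext x
    rw [mem_joinPts, hLdef, hRdef, Finset.mem_filter, Finset.mem_filter]
    constructor
    · intro hx
      rcases lt_trichotomy x.1 (p + l) with h1 | h1 | h1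
      · exact Or.inr (Or.inl ⟨hx, h1⟩)
      · exact Or.inl (h.fst_inj x hx _ htop h1)
      · exact Or.inr (Or.inr ⟨hx, h1⟩)
    · rintro (rfl | h1 | h1)
      exacts [htop, h1.1, h1.1]

/-- Crossing points increase in both coordinates, whereas `R` lies to the right of and below
everything else. The only mixed crossings join `L` to the greatest letter. -/
theorem crsPts_join {p v : ℤ} {l m : ℕ} {L R : Finset (ℤ × ℤ)} (hL : IsConfig p (v + m) l L)
    (hR : IsConfig (p + l + 1) v m R) : crsPts (joinPts p v l m L R) =
      crsPts L + crsPts R + (L.filter fun x => CrossPts x (p + l, v + l + m)).card := by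
  have h3 : (L.filter fun x => CrossPts x (p + l, v + l + m)).card =
      ((L.filter fun x => CrossPts x (p + l, v + l + m)).image
        fun x => (x, ((p + l, v + l + m) : ℤ × ℤ))).card :=
    (Finset.card_image_of_injective _ fun x y e => (Prod.ext_iff.1 e).1).symm
  rw [h3, crsPts, crsPts, crsPts, ← Finset.card_union_of_disjoint, ← Finset.card_union_of_disjoint]
  · congr 1
    ext ⟨x, y⟩
    simp only [Finset.mem_union, Finset.mem_filter, Finset.mem_product, mem_joinPts,
      Finset.mem_image, Prod.mk.injEq]
    constructor
    · rintro ⟨⟨hx, hy⟩, hc⟩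
      have hc' := hc
      rw [CrossPts] at hc'
      rcases hx with rfl | hx | hx <;> rcases hy with rfl | hy | hy
      · simp at hc'
      · have := hL.bounds y hy; simp at hc'; omega
      · have := hR.bounds y hy; simp at hc'; omega
      · exact Or.inr ⟨x, ⟨hx, hc⟩, rfl, rfl⟩
      · exact Or.inl (Or.inl ⟨⟨hx, hy⟩, hc⟩)
      · have := hL.bounds x hx; have := hR.bounds y hy; omega
      · have := hR.bounds x hx; simp at hc'; omega
      · have := hR.bounds x hx; have := hL.bounds y hy; omega
      · exact Or.inl (Or.inr ⟨⟨hx, hy⟩, hc⟩)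
    · rintro ((⟨⟨hx, hy⟩, hc⟩ | ⟨⟨hx, hy⟩, hc⟩) | ⟨z, ⟨hz, hc⟩, rfl, rfl⟩)
      · exact ⟨⟨Or.inr (Or.inl hx), Or.inr (Or.inl hy)⟩, hc⟩
      · exact ⟨⟨Or.inr (Or.inr hx), Or.inr (Or.inr hy)⟩, hc⟩
      · exact ⟨⟨Or.inr (Or.inl hz), Or.inl rfl⟩, hc⟩
  · rw [Finset.disjoint_left]
    rintro ⟨x, y⟩ h1 h2
    simp only [Finset.mem_union, Finset.mem_filter, Finset.mem_product, Finset.mem_image,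
      Prod.mk.injEq] at h1 h2
    obtain ⟨z, -, rfl, rfl⟩ := h2
    rcases h1 with h1 | h1
    · have := hL.bounds _ h1.1.2; simp at this
    · have := hR.bounds _ h1.1.2; simp at this
  · rw [Finset.disjoint_left]
    rintro ⟨x, y⟩ h1 h2
    simp only [Finset.mem_filter, Finset.mem_product] at h1 h2
    have := hL.bounds _ h1.1.1
    have := hR.bounds _ h2.1.1
    omega

/-- The crossings of the greatest letter with the letters to its left. -/
theorem card_crossPts_top {p v : ℤ} {l m : ℕ} {L : Finset (ℤ × ℤ)} (hL : IsConfig p (v + m) l L) :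
    2 * ((L.filter fun x => CrossPts x (p + l, v + l + m)).card : ℤ) + 1 =
      |(|p - v - l - m| - |p - v - l - m + 2 * l + 1|)| := by
  -- The greatest letter is the end of an upper arc or of a lower one; all its crossings are of that
  -- kind.
  rcases lt_or_ge (p + l) (v + l + m) with h | h
  · have : (L.filter fun x => CrossPts x (p + l, v + l + m)) = L.filter fun x => p + l < x.2 := by
      refine Finset.filter_congr fun x hx => ?_
      have := hL.bounds x hx
      simp only [CrossPts]
      omega
    rw [this, hL.card_filter_snd]
    have e : (Finset.Ico (v + m) (v + m + l)).filter (fun a => p + l < a) =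
        Finset.Ico (max (v + m) (p + l + 1)) (v + m + l) := by
      ext i; simp; omega
    rw [e, Int.card_Ico]
    rcases abs_cases (p - v - l - m) with h1 | h1 <;>
    rcases abs_cases (p - v - l - m + 2 * l + 1) with h2 | h2 <;>
    rcases abs_cases (|p - v - l - m| - |p - v - l - m + 2 * l + 1|) with h3 | h3 <;>
    omega
  · have : (L.filter fun x => CrossPts x (p + l, v + l + m)) =
        L.filter fun x => v + l + m ≤ x.1 := by
      refine Finset.filter_congr fun x hx => ?_
      have := hL.bounds x hx
      simp only [CrossPts]
      omega
    rw [this, hL.card_filter_fst (fun i => v + l + m ≤ i)]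
    have e : (Finset.Ico p (p + l)).filter (fun a => v + l + m ≤ a) =
        Finset.Ico (max p (v + l + m)) (p + l) := by
      ext i; simp
    rw [e, Int.card_Ico]
    rcases abs_cases (p - v - l - m) with h1 | h1 <;>
    rcases abs_cases (p - v - l - m + 2 * l + 1) with h2 | h2 <;>
    rcases abs_cases (|p - v - l - m| - |p - v - l - m + 2 * l + 1|) with h3 | h3 <;>
    omega

open Classical in
/-- All graphs of 132-avoiding bijections from `[p, p + n)` to `[v, v + n)`. -/
noncomputable def configs (p v : ℤ) (n : ℕ) : Finset (Finset (ℤ × ℤ)) :=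
  (Finset.Ico p (p + n) ×ˢ Finset.Ico v (v + n)).powerset.filter (IsConfig p v n)

theorem mem_configs {p v : ℤ} {n : ℕ} {A : Finset (ℤ × ℤ)} :
    A ∈ configs p v n ↔ IsConfig p v n A := by
  simp only [configs, Finset.mem_filter, Finset.mem_powerset, and_iff_right_iff_imp]
  intro h x hx
  have := h.bounds x hx
  simp; omega

theorem joinPts_left {p v : ℤ} {l m : ℕ} {L R : Finset (ℤ × ℤ)} (hL : IsConfig p (v + m) l L)
    (hR : IsConfig (p + l + 1) v m R) :
    (joinPts p v l m L R).filter (fun x => x.1 < p + l) = L := by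
  ext x
  rw [Finset.mem_filter, mem_joinPts]
  constructor
  · rintro ⟨rfl | h | h, h'⟩
    · simp at h'
    · exact h
    · have := hR.bounds x h; omega
  · intro h
    have := hL.bounds x h
    exact ⟨Or.inr (Or.inl h), by omega⟩

theorem joinPts_right {p v : ℤ} {l m : ℕ} {L R : Finset (ℤ × ℤ)} (hL : IsConfig p (v + m) l L)
    (hR : IsConfig (p + l + 1) v m R) :
    (joinPts p v l m L R).filter (fun x => p + l < x.1) = R := by
  ext x
  rw [Finset.mem_filter, mem_joinPts]
  constructor
  · rintro ⟨rfl | h | h, h'⟩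
    · simp at h'
    · have := hL.bounds x h; omega
    · exact h
  · intro h
    have := hR.bounds x h
    exact ⟨Or.inr (Or.inr h), by omega⟩

theorem joinPts_top {p v : ℤ} {l m l' m' : ℕ} {L R : Finset (ℤ × ℤ)}
    (hL : IsConfig p (v + m) l L) (hR : IsConfig (p + l + 1) v m R) (hlm : l + m = l' + m')
    (h : ((p + l', v + l' + m') : ℤ × ℤ) ∈ joinPts p v l m L R) : l' = l := by
  rcases mem_joinPts.1 h with h | h | h
  · simpa using (Prod.ext_iff.1 h).1
  · have := hL.bounds _ h; simp at this; omega
  · have := hR.bounds _ h; simp at this; omega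

theorem sum_configs_succ (p v : ℤ) (n : ℕ) (F : Finset (ℤ × ℤ) → ℝ) :
    ∑ A ∈ configs p v (n + 1), F A = ∑ x ∈ Finset.HasAntidiagonal.antidiagonal n,
      ∑ y ∈ configs p (v + x.2) x.1 ×ˢ configs (p + x.1 + 1) v x.2,
        F (joinPts p v x.1 x.2 y.1 y.2) := by
  rw [Finset.sum_sigma']
  symm
  refine Finset.sum_bij (fun z _ => joinPts p v z.1.1 z.1.2 z.2.1 z.2.2) ?_ ?_ ?_ fun _ _ => rfl
  · rintro ⟨⟨l, m⟩, ⟨L, R⟩⟩ h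
    simp only [Finset.mem_sigma, Finset.HasAntidiagonal.mem_antidiagonal, Finset.mem_product,
      mem_configs] at h ⊢
    obtain ⟨rfl, hL, hR⟩ := h
    exact hL.join hR
  · rintro ⟨⟨l, m⟩, ⟨L, R⟩⟩ h ⟨⟨l', m'⟩, ⟨L', R'⟩⟩ h' e
    simp only [Finset.mem_sigma, Finset.HasAntidiagonal.mem_antidiagonal, Finset.mem_product,
      mem_configs] at h h' e
    obtain ⟨h, hL, hR⟩ := h
    obtain ⟨h', hL', hR'⟩ := h'
    obtain rfl : l' = l := joinPts_top hL hR (h.trans h'.symm) (by rw [e]; exact mem_joinPts.2 (Or.inl rfl))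
    obtain rfl : m' = m := by omega
    have e1 : L = L' := by rw [← joinPts_left hL hR, e, joinPts_left hL' hR']
    have e2 : R = R' := by rw [← joinPts_right hL hR, e, joinPts_right hL' hR']
    rw [e1, e2]
  · intro A hA
    obtain ⟨l, m, L, R, h, hL, hR, rfl⟩ := (mem_configs.1 hA).exists_join
    refine ⟨⟨(l, m), (L, R)⟩, ?_, rfl⟩
    simp only [Finset.mem_sigma, Finset.HasAntidiagonal.mem_antidiagonal, Finset.mem_product,
      mem_configs]
    exact ⟨h, hL, hR⟩

theorem configs_zero (p v : ℤ) : configs p v 0 = {∅} := by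
  ext A
  rw [mem_configs, Finset.mem_singleton]
  constructor
  · exact fun h => Finset.card_eq_zero.1 h.card
  · rintro rfl
    constructor <;> simp

/-- The factor s ^ n gives each letter one more s, so the greatest letter contributes s ^ (2 c + 1),
where c counts its crossings with `L`: the weight of a matched pair. Only `p - v` matters, and the
two parts sit on shifted intervals, whence the general `p` and `v`. -/
theorem sum_pow_crsPts (s : ℝ) (n : ℕ) (p v : ℤ) :
    s ^ n * ∑ A ∈ configs p v n, (s ^ 2) ^ crsPts A = dyckSum s n (p - v - n) := by
  induction n using Nat.strong_induction_on generalizing p v with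
  | _ n ih =>
  rcases n with _ | n
  · simp [configs_zero, crsPts, dyckSum_zero]
  rw [sum_configs_succ, dyckSum_succ, Finset.mul_sum]
  refine Finset.sum_congr rfl fun ⟨l, m⟩ hx => ?_
  rw [Finset.HasAntidiagonal.mem_antidiagonal] at hx
  dsimp only at hx ⊢
  have e1 : p - v - ((n + 1 : ℕ) : ℤ) + 1 = p - v - l - m := by rw [← hx]; push_cast; ring
  have e2 : p - v - ((n + 1 : ℕ) : ℤ) + 2 * l + 2 = p - v - l - m + 2 * l + 1 := by
    rw [← hx]; push_cast; ring
  have hl := ih l (by omega) p (v + m)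
  have hm := ih m (by omega) (p + l + 1) v
  rw [show p - (v + m) - (l : ℤ) = p - v - l - m by ring] at hl
  rw [show p + l + 1 - v - (m : ℤ) = p - v - l - m + 2 * l + 1 by ring] at hm
  rw [e1, e2, ← hl, ← hm, Finset.sum_product, mul_assoc, mul_mul_mul_comm, Finset.sum_mul_sum,
    Finset.mul_sum, Finset.mul_sum, Finset.mul_sum]
  refine Finset.sum_congr rfl fun L hL => ?_
  rw [Finset.mul_sum, Finset.mul_sum, Finset.mul_sum]
  refine Finset.sum_congr rfl fun R hR => ?_
  rw [mem_configs] at hL hR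
  rw [crsPts_join hL hR, ← card_crossPts_top hL, ← hx]
  norm_cast
  ring

/-! ### From point configurations back to permutations -/

/-- The graph of a permutation. -/
def graphPts {n : ℕ} (σ : S n) : Finset (ℤ × ℤ) :=
  Finset.univ.image fun i : Fin n => ((i.val : ℤ), ((σ i).val : ℤ))

theorem mem_graphPts {n : ℕ} {σ : S n} {x : ℤ × ℤ} :
    x ∈ graphPts σ ↔ ∃ i : Fin n, ((i.val : ℤ), ((σ i).val : ℤ)) = x := by
  simp [graphPts]

theorem graphPts_injective (n : ℕ) : Function.Injective (graphPts (n := n)) := by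
  intro σ τ h
  ext i
  have : ((i.val : ℤ), ((σ i).val : ℤ)) ∈ graphPts τ := h ▸ mem_graphPts.2 ⟨i, rfl⟩
  obtain ⟨j, hj⟩ := mem_graphPts.1 this
  simp only [Prod.mk.injEq, Nat.cast_inj, Fin.val_inj] at hj
  rw [← hj.2, hj.1]

theorem isConfig_graphPts {n : ℕ} {σ : S n} (hσ : ¬ ContainsThree p132 σ) :
    IsConfig 0 0 n (graphPts σ) where
  bounds := by
    intro x hx
    obtain ⟨i, rfl⟩ := mem_graphPts.1 hx
    simp
  card := by
    rw [graphPts, Finset.card_image_of_injective, Finset.card_univ, Fintype.card_fin]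
    intro i j h
    simpa [Fin.val_inj] using (Prod.ext_iff.1 h).1
  fst_inj := by
    intro x hx y hy e
    obtain ⟨i, rfl⟩ := mem_graphPts.1 hx
    obtain ⟨j, rfl⟩ := mem_graphPts.1 hy
    simp only [Nat.cast_inj, Fin.val_inj] at e
    rw [e]
  snd_inj := by
    intro x hx y hy e
    obtain ⟨i, rfl⟩ := mem_graphPts.1 hx
    obtain ⟨j, rfl⟩ := mem_graphPts.1 hy
    simp only [Nat.cast_inj, Fin.val_inj, EmbeddingLike.apply_eq_iff_eq] at e
    rw [e]
  avoid := by
    intro x hx y hy z hz h1 h2 h3 h4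
    obtain ⟨i, rfl⟩ := mem_graphPts.1 hx
    obtain ⟨j, rfl⟩ := mem_graphPts.1 hy
    obtain ⟨k, rfl⟩ := mem_graphPts.1 hz
    simp only [Nat.cast_lt, Fin.val_fin_lt] at h1 h2 h3 h4
    exact hσ ((containsThree_p132 σ).2 ⟨i, j, k, h1, h2, h3, h4⟩)

theorem IsConfig.exists_graphPts {n : ℕ} {A : Finset (ℤ × ℤ)} (h : IsConfig 0 0 n A) :
    ∃ σ : S n, ¬ ContainsThree p132 σ ∧ graphPts σ = A := by
  have hf : ∀ i : Fin n, ∃ k : Fin n, ((i.val : ℤ), (k.val : ℤ)) ∈ A := fun i => by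
    obtain ⟨⟨a, b⟩, hx, rfl⟩ := h.exists_fst (i := i.val) (by omega) (by have := i.isLt; omega)
    have := h.bounds _ hx
    dsimp only at this
    refine ⟨⟨b.toNat, by omega⟩, ?_⟩
    rwa [Int.toNat_of_nonneg (by omega)]
  choose f hf using hf
  have hinj : Function.Injective f := fun i j e => by
    have := h.snd_inj _ (hf i) _ (hf j) (by rw [e])
    simpa [Fin.val_inj] using (Prod.ext_iff.1 this).1
  refine ⟨Equiv.ofBijective f (Finite.injective_iff_bijective.1 hinj), ?_, ?_⟩
  · rw [containsThree_p132]
    rintro ⟨a, b, c, h1, h2, h3, h4⟩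
    simp only [Equiv.ofBijective_apply] at h3 h4
    exact h.avoid _ (hf a) _ (hf b) _ (hf c) (by simpa using h1) (by simpa using h2)
      (by simpa using h3) (by simpa using h4)
  · ext x
    rw [mem_graphPts]
    constructor
    · rintro ⟨i, rfl⟩
      exact hf i
    · intro hx
      have := h.bounds x hx
      refine ⟨⟨x.1.toNat, by omega⟩, h.fst_inj _ (hf _) _ hx ?_⟩
      simp; omega

theorem crsPts_graphPts {n : ℕ} (σ : S n) : crsPts (graphPts σ) = crs n σ := by
  symm
  refine Finset.card_bij (fun x _ => (((x.1.val : ℤ), ((σ x.1).val : ℤ)),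
    ((x.2.val : ℤ), ((σ x.2).val : ℤ)))) ?_ ?_ ?_
  · rintro ⟨i, j⟩ h
    rw [Finset.mem_filter_univ] at h
    simp only [IsCrossing] at h
    rw [Finset.mem_filter, Finset.mem_product, mem_graphPts, mem_graphPts]
    simp only [CrossPts]
    refine ⟨⟨⟨i, rfl⟩, ⟨j, rfl⟩⟩, ?_⟩
    omega
  · rintro ⟨i, j⟩ - ⟨i', j'⟩ - e
    simp only [Prod.mk.injEq, Nat.cast_inj, Fin.val_inj] at e ⊢
    exact ⟨e.1.1, e.2.1⟩
  · rintro ⟨x, y⟩ h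
    simp only [Finset.mem_filter, Finset.mem_product, mem_graphPts] at h
    obtain ⟨⟨⟨i, rfl⟩, ⟨j, rfl⟩⟩, h⟩ := h
    refine ⟨(i, j), ?_, rfl⟩
    rw [Finset.mem_filter_univ]
    simp only [IsCrossing]
    simp only [CrossPts] at h
    omega

theorem sum_pow_crs_p132 (q : ℝ) (n : ℕ) :
    ∑ σ ∈ avoiders {⟨3, p132⟩} n, q ^ crs n σ = ∑ A ∈ configs 0 0 n, q ^ crsPts A := by
  refine Finset.sum_bij (fun σ _ => graphPts σ) ?_ ?_ ?_ ?_
  · intro σ hσ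
    exact mem_configs.2 (isConfig_graphPts ((mem_avoiders _ _).1 hσ))
  · exact fun σ _ τ _ h => graphPts_injective n h
  · intro A hA
    obtain ⟨σ, h1, h2⟩ := (mem_configs.1 hA).exists_graphPts
    exact ⟨σ, (mem_avoiders _ _).2 h1, h2⟩
  · intro σ _
    rw [crsPts_graphPts]

/-! ### The equivalence of 132 and 321 -/

theorem sum_pow_crs_p132_eq_p321 {s : ℝ} (hs : s ≠ 0) (n : ℕ) :
    ∑ σ ∈ avoiders {⟨3, p132⟩} n, (s ^ 2) ^ crs n σ =
      ∑ σ ∈ avoiders {⟨3, p321⟩} n, (s ^ 2) ^ crs n σ := by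
  rcases n with _ | t
  · have h : ∀ τ : S 3, avoiders {⟨3, τ⟩} 0 = Finset.univ := fun τ => by
      rw [avoiders_eq_filter, Finset.filter_true_of_mem]
      rintro σ - ⟨a, -⟩
      exact a.elim0
    rw [h, h]
  · have h1 := sum_pow_crsPts s (t + 1) 0 0
    have e : (0 : ℤ) - 0 - ((t + 1 : ℕ) : ℤ) = -t - 1 := by push_cast; ring
    rw [e, dyckSum_centered hs] at h1
    rw [sum_pow_crs_p132, sum_pow_crs_p321]
    exact mul_left_cancel₀ (pow_ne_zero _ hs) h1

theorem wilfEquiv_of_sum_pow_eq {st : Statistic} {T T' : Set Pattern}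
    (h : ∀ s : ℝ, s ≠ 0 → ∀ n,
      ∑ σ ∈ avoiders T n, (s ^ 2) ^ st n σ = ∑ σ ∈ avoiders T' n, (s ^ 2) ^ st n σ) :
    WilfEquiv ![st] T T' := fun n => by
  have key : ∑ σ ∈ avoiders T n, (Polynomial.X : Polynomial ℤ) ^ st n σ =
      ∑ σ ∈ avoiders T' n, (Polynomial.X : Polynomial ℤ) ^ st n σ := by
    apply Polynomial.map_injective (Int.castRingHom ℝ) Int.cast_injective
    -- Every x > 0 is s ^ 2 with s = √x, so the polynomials agree at infinitely many points.
    refine Polynomial.eq_of_infinite_eval_eq _ _ ((Set.Ioi_infinite (0 : ℝ)).mono fun x hx => ?_)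
    have := h (Real.sqrt x) (Real.sqrt_pos.2 hx).ne' n
    rw [Real.sq_sqrt (le_of_lt hx)] at this
    simpa [Polynomial.eval_finsetSum, Polynomial.map_sum] using this
  have := congrArg (Polynomial.aeval (MvPolynomial.X 0 : MvPolynomial (Fin 1) ℤ)) key
  simpa [genPoly] using this

theorem wilfEquiv_crs_p132_p321 : WilfEquiv ![crs] {⟨3, p132⟩} {⟨3, p321⟩} :=
  wilfEquiv_of_sum_pow_eq fun _ => sum_pow_crs_p132_eq_p321

/-! ### The classes -/

theorem exists_S_three {P : S 3 → Prop} : (∃ τ, P τ) ↔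
    P p123 ∨ P p132 ∨ P p213 ∨ P p231 ∨ P p312 ∨ P p321 := by
  have : ∀ τ : S 3, τ = p123 ∨ τ = p132 ∨ τ = p213 ∨ τ = p231 ∨ τ = p312 ∨ τ = p321 := by decide
  constructor
  · rintro ⟨τ, h⟩
    rcases this τ with rfl | rfl | rfl | rfl | rfl | rfl <;> simp [h]
  · rintro (h | h | h | h | h | h) <;> exact ⟨_, h⟩

theorem wilfClasses_three {k : ℕ} (st : Fin k → Statistic) : wilfClasses st 3 =
    {wilfClass st p123, wilfClass st p132, wilfClass st p213, wilfClass st p231,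
      wilfClass st p312, wilfClass st p321} := by
  ext A
  have : A ∈ wilfClasses st 3 ↔ ∃ τ, A = wilfClass st τ := Iff.rfl
  rw [this, exists_S_three]
  rfl

theorem wilfClass_congr {k l : ℕ} {st : Fin k → Statistic} {τ τ' : S l}
    (h : WilfEquiv st {⟨l, τ⟩} {⟨l, τ'⟩}) : wilfClass st τ = wilfClass st τ' := by
  ext π
  exact ⟨fun h' n => (h' n).trans (h n), fun h' n => (h' n).trans (h n).symm⟩

theorem wilfClass_eq {k l : ℕ} {st : Fin k → Statistic} {τ : S l} {A : Set (S l)}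
    (h : ∀ π ∈ A, WilfEquiv st {⟨l, π⟩} {⟨l, τ⟩})
    (h' : ∀ π, WilfEquiv st {⟨l, π⟩} {⟨l, τ⟩} → π ∈ A) : wilfClass st τ = A :=
  Set.Subset.antisymm h' h

theorem WilfEquiv.refl {k : ℕ} (st : Fin k → Statistic) (T : Set Pattern) : WilfEquiv st T T :=
  fun _ => rfl

theorem WilfEquiv.symm {k : ℕ} {st : Fin k → Statistic} {T T' : Set Pattern}
    (h : WilfEquiv st T T') : WilfEquiv st T' T := fun n => (h n).symm

/-- Checked over the 24 permutations of length 4; one value of the polynomial is enough. -/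
theorem weightTwo_nes_cases : ∀ π τ : S 3, weightTwo nes π 4 = weightTwo nes τ 4 →
    π = τ ∨ (π = p132 ∧ τ = p213) ∨ (π = p213 ∧ τ = p132) ∨ (π = p231 ∧ τ = p312) ∨
      (π = p312 ∧ τ = p231) := by
  decide +kernel

theorem weightTwo_crs_cases : ∀ π τ : S 3, weightTwo crs π 4 = weightTwo crs τ 4 →
    π = τ ∨ ((π = p132 ∨ π = p213 ∨ π = p321) ∧ (τ = p132 ∨ τ = p213 ∨ τ = p321)) := by
  decide +kernel

theorem wilfEquiv_nes_cases {π τ : S 3} (h : WilfEquiv ![nes] {⟨3, π⟩} {⟨3, τ⟩}) :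
    π = τ ∨ (π = p132 ∧ τ = p213) ∨ (π = p213 ∧ τ = p132) ∨ (π = p231 ∧ τ = p312) ∨
      (π = p312 ∧ τ = p231) :=
  weightTwo_nes_cases π τ (weightTwo_eq_of_wilfEquiv h 4)

theorem wilfEquiv_crs_cases {π τ : S 3} (h : WilfEquiv ![crs] {⟨3, π⟩} {⟨3, τ⟩}) :
    π = τ ∨ ((π = p132 ∨ π = p213 ∨ π = p321) ∧ (τ = p132 ∨ τ = p213 ∨ τ = p321)) :=
  weightTwo_crs_cases π τ (weightTwo_eq_of_wilfEquiv h 4)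

theorem patterns_ne : p123 ≠ p132 ∧ p123 ≠ p213 ∧ p123 ≠ p231 ∧ p123 ≠ p312 ∧ p123 ≠ p321 ∧
    p132 ≠ p213 ∧ p132 ≠ p231 ∧ p132 ≠ p312 ∧ p132 ≠ p321 ∧ p213 ≠ p231 ∧ p213 ≠ p312 ∧
    p213 ≠ p321 ∧ p231 ≠ p312 ∧ p231 ≠ p321 ∧ p312 ≠ p321 := by
  decide

theorem wilfClass_nes : wilfClass ![nes] p123 = {p123} ∧ wilfClass ![nes] p321 = {p321} ∧
    wilfClass ![nes] p132 = {p132, p213} ∧ wilfClass ![nes] p213 = {p132, p213} ∧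
    wilfClass ![nes] p231 = {p231, p312} ∧ wilfClass ![nes] p312 = {p231, p312} := by
  have hne := patterns_ne
  have e1 := wilfEquiv_snd wilfEquiv_crs_nes_p132_p213
  have e2 := wilfEquiv_nes_p231_p312
  have h1 : wilfClass ![nes] p132 = {p132, p213} :=
    wilfClass_eq (by rintro π (rfl | rfl); exacts [.refl _ _, e1.symm])
      fun π h => by have := wilfEquiv_nes_cases h; simp; grind
  have h2 : wilfClass ![nes] p231 = {p231, p312} :=
    wilfClass_eq (by rintro π (rfl | rfl); exacts [.refl _ _, e2.symm])
      fun π h => by have := wilfEquiv_nes_cases h; simp; grind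
  refine ⟨wilfClass_eq ?_ ?_, wilfClass_eq ?_ ?_, h1, wilfClass_congr e1 ▸ h1, h2,
    wilfClass_congr e2 ▸ h2⟩
  · rintro π rfl; exact .refl _ _
  · intro π h; have := wilfEquiv_nes_cases h; simp; grind
  · rintro π rfl; exact .refl _ _
  · intro π h; have := wilfEquiv_nes_cases h; simp; grind

theorem wilfClass_crs : wilfClass ![crs] p123 = {p123} ∧ wilfClass ![crs] p312 = {p312} ∧
    wilfClass ![crs] p231 = {p231} ∧ wilfClass ![crs] p132 = {p132, p213, p321} ∧
    wilfClass ![crs] p213 = {p132, p213, p321} ∧ wilfClass ![crs] p321 = {p132, p213, p321} := by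
  have hne := patterns_ne
  have e1 := wilfEquiv_fst wilfEquiv_crs_nes_p132_p213
  have e2 := wilfEquiv_crs_p132_p321
  have h1 : wilfClass ![crs] p132 = {p132, p213, p321} :=
    wilfClass_eq (by rintro π (rfl | rfl | rfl); exacts [.refl _ _, e1.symm, e2.symm])
      fun π h => by have := wilfEquiv_crs_cases h; simp; grind
  refine ⟨wilfClass_eq ?_ ?_, wilfClass_eq ?_ ?_, wilfClass_eq ?_ ?_, h1, wilfClass_congr e1 ▸ h1,
    wilfClass_congr e2 ▸ h1⟩
  · rintro π rfl; exact .refl _ _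
  · intro π h; have := wilfEquiv_crs_cases h; simp; grind
  · rintro π rfl; exact .refl _ _
  · intro π h; have := wilfEquiv_crs_cases h; simp; grind
  · rintro π rfl; exact .refl _ _
  · intro π h; have := wilfEquiv_crs_cases h; simp; grind

theorem wilfClass_crs_nes : wilfClass ![crs, nes] p123 = {p123} ∧
    wilfClass ![crs, nes] p321 = {p321} ∧ wilfClass ![crs, nes] p312 = {p312} ∧
    wilfClass ![crs, nes] p231 = {p231} ∧ wilfClass ![crs, nes] p132 = {p132, p213} ∧
    wilfClass ![crs, nes] p213 = {p132, p213} := by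
  have hne := patterns_ne
  have e1 := wilfEquiv_crs_nes_p132_p213
  have hcases : ∀ {π τ : S 3}, WilfEquiv ![crs, nes] {⟨3, π⟩} {⟨3, τ⟩} →
      -- Of the pairs equivalent for one statistic, `nes` separates 321 from 132 and 213, and `crs`
      -- separates 231 from 312.
      π = τ ∨ (π = p132 ∧ τ = p213) ∨ (π = p213 ∧ τ = p132) := fun h => by
    have h1 := wilfEquiv_crs_cases (wilfEquiv_fst h)
    have h2 := wilfEquiv_nes_cases (wilfEquiv_snd h)
    grind
  have h1 : wilfClass ![crs, nes] p132 = {p132, p213} :=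
    wilfClass_eq (by rintro π (rfl | rfl); exacts [.refl _ _, e1.symm])
      fun π h => by have := hcases h; simp; grind
  refine ⟨wilfClass_eq ?_ ?_, wilfClass_eq ?_ ?_, wilfClass_eq ?_ ?_, wilfClass_eq ?_ ?_, h1,
    wilfClass_congr e1 ▸ h1⟩
  · rintro π rfl; exact .refl _ _
  · intro π h; have := hcases h; simp; grind
  · rintro π rfl; exact .refl _ _
  · intro π h; have := hcases h; simp; grind
  · rintro π rfl; exact .refl _ _
  · intro π h; have := hcases h; simp; grind
  · rintro π rfl; exact .refl _ _
  · intro π h; have := hcases h; simp; grind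

end PermPattern

theorem theorem1 :
    -- the classes modulo nes
    (wilfClasses ![nes] 3 = {{p123}, {p321}, {p132, p213}, {p231, p312}} ∧
      wilfClass ![nes] p132 = {p132, p213} ∧ wilfClass ![nes] p231 = {p231, p312}) ∧
    -- the classes modulo crs
    (wilfClasses ![crs] 3 = {{p123}, {p312}, {p231}, {p132, p213, p321}} ∧
      wilfClass ![crs] p132 = {p132, p213, p321}) ∧
    -- the classes modulo (crs, nes)
    (wilfClasses ![crs, nes] 3 = {{p123}, {p321}, {p312}, {p231}, {p132, p213}} ∧
      wilfClass ![crs, nes] p132 = {p132, p213}) := by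
  obtain ⟨a1, a2, a3, a4, a5, a6⟩ := wilfClass_nes
  obtain ⟨b1, b2, b3, b4, b5, b6⟩ := wilfClass_crs
  obtain ⟨c1, c2, c3, c4, c5, c6⟩ := wilfClass_crs_nes
  refine ⟨⟨?_, a3, a5⟩, ⟨?_, b4⟩, ⟨?_, c5⟩⟩
  · rw [wilfClasses_three, a1, a2, a3, a4, a5, a6]
    ext A; simp only [Set.mem_insert_iff, Set.mem_singleton_iff]; tauto
  · rw [wilfClasses_three, b1, b2, b3, b4, b5, b6]
    ext A; simp only [Set.mem_insert_iff, Set.mem_singleton_iff]; tauto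
  · rw [wilfClasses_three, c1, c2, c3, c4, c5, c6]
    ext A; simp only [Set.mem_insert_iff, Set.mem_singleton_iff]; tauto
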